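/- **Setting.** For $g\in L^1(\mathbb R^n)$ real-valued let $\hat g(\omega)=(2\pi)^{-n}\int g(x)e^{-i\langle\omega,x\rangle}dx$; for vector-valued $g$ the Fourier transform is taken componentwise. For a bounded set $B\subseteq\mathbb R^n$ let $\|\omega\|_B=\sup_{x\in B}|\langle\omega,x\rangle|$, and let $\mathcal F_B$ be the set of $g\in L^1(\mathbb R^n)$ with $g(x)=g(0)+\int(e^{i\langle\omega,x\rangle}-1)\hat g(\omega)\,d\omega$ for all $x\in B$ (the integrand being integrable). A function $f$ is *$C$-Barron on $B$*, $f\in\Gamma_B(C)$, if some $g$ with components in $\mathcal F_B$ satisfies $g|_B=f|_B$ and $\int\|\omega\|_B\,\|\hat g(\omega)\|_2\,d\omega\le C$; for vector-valued $f$, $\|\hat g(\omega)\|_2$ is the Euclidean norm of the vector $\hat g(\omega)$. We call $f$ *componentwise $C$-Barron on $B$* if each of its (real-valued) components is $C$-Barron on $B$; this is the weaker property. A function $\sigma:\mathbb R\to\mathbb R$ is *sigmoidal* if it is bounded and measurable with $\sigma(x)\to0$ as $x\to-\infty$ and $\sigma(x)\to1$ as $x\to\infty$. A neural network with $l$ hidden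 layers and activation $\sigma$ computes $x^{(0)}=x$, $x^{(i)}=\sigma(A^{(i)}x^{(i-1)}+b^{(i)})$ for $1\le i\le l$ ($\sigma$ applied entrywise), and outputs $A^{(l+1)}x^{(l)}+b^{(l+1)}$; the number of nodes on the $i$th layer is the dimension of $x^{(i)}$. For probability measures $\mu,\nu$ on $\mathbb R^n$, $W_2(\mu,\nu)=\big(\inf_\gamma\int\|x-y\|_2^2\,d\gamma(x,y)\big)^{1/2}$ over all couplings $\gamma$ of $\mu$ and $\nu$. $B_n$ is the closed Euclidean unit ball of $\mathbb R^n$. **Statement.** Let $\varepsilon,s>0$, $l\ge1$, $m_0,\dots,m_l\in\mathbb N$, $f_i:\mathbb R^{m_{i-1}}\to\mathbb R^{m_i}$ for $1\le i\le l$, $C_1,\dots,C_l\in\mathbb R$, $\mu_0$ a probability measure on $\mathbb R^{m_0}$, and $K_i\subseteq\mathbb R^{m_i}$ for $0\le i\le l$ sets, bounded for $i<l$. Suppose that 1. $\operatorname{Supp}(\mu_0)\subseteq K_0$; 2. each $f_i$ is $1$-Lipschitz for the Euclidean norms; 3. $f_1$ is componentwise $C_1$-Barron on $K_0$, and for $2\le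 i\le l$, $f_i$ is componentwise $C_i$-Barron on $K_{i-1}+sB_{m_{i-1}}$; 4. $f_i(K_{i-1})\subseteq K_i$ for $1\le i\le l$. Let $D$ be the diameter of $(f_l\circ\cdots\circ f_1)(K_0)$, let $r_i=\lceil 4C_i^2m_i/\varepsilon^2\rceil$, and let $\sigma$ be any sigmoidal function. (a) If moreover $f_1\in\Gamma_{K_0}(C_1)$ and $f_i\in\Gamma_{K_{i-1}+sB_{m_{i-1}}}(C_i)$ for $2\le i\le l$ (as vector-valued functions), then there is a neural network $g$ with activation $\sigma$ and $l$ hidden layers, with $r_i$ nodes on the $i$th layer, such that, for $X\sim\mu_0$, $$W_2\big(\mathrm{law}\,(f_l\circ\cdots\circ f_1)(X),\ \mathrm{law}\,g(X)\big)\le l\varepsilon\sqrt{1+(2C_l\sqrt{m_l}+D)^2\frac{l}{3s^2}}.$$ (b) Without the additional hypothesis of (a), there is a neural network $g$ with activation $\sigma$ and $l$ hidden layers, with $m_ir_i$ nodes on the $i$th layer ($r_i$ for each coordinate of $f_i$), that satisfies the same inequality. -/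

import Mathlib

open MeasureTheory Filter Topology
open scoped ENNReal Pointwise

noncomputable section

namespace BarronNet

/-- `ℝⁿ` with its Euclidean norm. -/
abbrev Euc (n : ℕ) : Type := EuclideanSpace ℝ (Fin n)

/-- `f 0, f 1, f 2, …` is the chain `f₁, f₂, f₃, …`; `chain f l = f_l ∘ ⋯ ∘ f₁`. -/
def chain {m : ℕ → ℕ} (f : ∀ i, Euc (m i) → Euc (m (i + 1))) : ∀ l, Euc (m 0) → Euc (m l)
  | 0 => id
  | l + 1 => f l ∘ chain f l

/-! ### Fourier transform and Barron functions -/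

/-- The Fourier transform `ĝ(ω) = (2π)⁻ⁿ ∫ g(x) exp(-i⟨ω, x⟩) dx` of `g ∈ L¹(ℝⁿ)`. -/
def fourierT {n : ℕ} (g : Euc n → ℝ) (ω : Euc n) : ℂ :=
  (((2 * Real.pi) ^ n)⁻¹ : ℝ) *
    ∫ x : Euc n, (g x : ℂ) * Complex.exp (-(Complex.I * (inner ℝ ω x : ℝ)))

/-- The Fourier transform of a vector-valued function, taken componentwise. -/
def fourierVec {n m : ℕ} (g : Euc n → Euc m) (ω : Euc n) : EuclideanSpace ℂ (Fin m) :=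
  WithLp.toLp 2 fun j => fourierT (fun x => g x j) ω

/-- `‖ω‖_B = sup_{x ∈ B} |⟨ω, x⟩|`, for a bounded set `B`. -/
def dualNorm {n : ℕ} (B : Set (Euc n)) (ω : Euc n) : ℝ :=
  sSup ((fun x => |(inner ℝ ω x : ℝ)|) '' B)

/-- The class `𝓕_B` of those `g ∈ L¹(ℝⁿ)` for which the Fourier inversion formula holds on `B`
after subtracting `g(0)`. -/
def FourierInversionOn {n : ℕ} (B : Set (Euc n)) (g : Euc n → ℝ) : Prop :=
  Integrable g ∧ ∀ x ∈ B,
    Integrable (fun ω : Euc n =>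
      (Complex.exp (Complex.I * (inner ℝ ω x : ℝ)) - 1) * fourierT g ω) ∧
    (g x : ℂ) = g 0 + ∫ ω : Euc n,
      (Complex.exp (Complex.I * (inner ℝ ω x : ℝ)) - 1) * fourierT g ω

/-- `f|_B ∈ Γ_B(C)` for real-valued `f`: some `g ∈ 𝓕_B` agrees with `f` on `B` and has
`∫ ‖ω‖_B |ĝ(ω)| dω ≤ C`. -/
def IsBarron {n : ℕ} (B : Set (Euc n)) (C : ℝ) (f : Euc n → ℝ) : Prop :=
  ∃ g : Euc n → ℝ, Set.EqOn g f B ∧ FourierInversionOn B g ∧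
    Integrable (fun ω : Euc n => dualNorm B ω * ‖fourierT g ω‖) ∧
    ∫ ω : Euc n, dualNorm B ω * ‖fourierT g ω‖ ≤ C

/-- Each component of `f` is `C`-Barron on `B`. -/
def IsBarronComponentwise {n m : ℕ} (B : Set (Euc n)) (C : ℝ) (f : Euc n → Euc m) : Prop :=
  ∀ j, IsBarron B C fun x => f x j

/-- `f|_B ∈ Γ_B(C)` for vector-valued `f`: as in the real-valued case, with the Fourier transform
taken componentwise and `|ĝ(ω)|` the Euclidean norm of the vector `ĝ(ω)`. -/
def IsBarronVec {n m : ℕ} (B : Set (Euc n)) (C : ℝ) (f : Euc n → Euc m) : Prop :=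
  ∃ g : Euc n → Euc m, Set.EqOn g f B ∧ (∀ j, FourierInversionOn B fun x => g x j) ∧
    Integrable (fun ω : Euc n => dualNorm B ω * ‖fourierVec g ω‖) ∧
    ∫ ω : Euc n, dualNorm B ω * ‖fourierVec g ω‖ ≤ C

/-- The set on which the `(i+1)`-st function of the chain has to be Barron: `K₀` for the first
function, and the neighbourhood `K_i + s B` (`B` the closed unit ball) for the later ones. -/
def barronDomain {m : ℕ → ℕ} (K : ∀ i, Set (Euc (m i))) (s : ℝ) : ∀ i, Set (Euc (m i))
  | 0 => K 0
  | i + 1 => K (i + 1) + s • Metric.closedBall (0 : Euc (m (i + 1))) 1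

/-! ### Neural networks -/

/-- A sigmoidal function. -/
structure IsSigmoidal (σ : ℝ → ℝ) : Prop where
  measurable : Measurable σ
  bounded : ∃ M : ℝ, ∀ x, |σ x| ≤ M
  tendsto_atBot : Tendsto σ atBot (𝓝 0)
  tendsto_atTop : Tendsto σ atTop (𝓝 1)

/-- Sizes of the layers of a network with input dimension `p` whose `i`-th hidden layer,
`i = 1, 2, …`, has `w i` nodes; layer `0` is the input. -/
def layerSize (p : ℕ) (w : ℕ → ℕ) : ℕ → ℕ
  | 0 => p
  | i + 1 => w (i + 1)

/-- The parameters of a feedforward network with input space `ℝᵖ`, output space `ℝ^q` and `l` hidden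
layers of sizes `w 1, …, w l`. -/
structure NeuralNetwork (p q l : ℕ) (w : ℕ → ℕ) where
  /-- weights leading from layer `i` to the hidden layer `i + 1` -/
  A : ∀ i : Fin l, Matrix (Fin (layerSize p w (i + 1))) (Fin (layerSize p w i)) ℝ
  /-- biases of the hidden layer `i + 1` -/
  b : ∀ i : Fin l, Fin (layerSize p w (i + 1)) → ℝ
  /-- weights of the linear output layer -/
  Aout : Matrix (Fin q) (Fin (layerSize p w l)) ℝ
  /-- biases of the linear output layer -/
  bout : Fin q → ℝ

/-- The values `x⁽ⁱ⁾` on layer `i ≤ l` for the input `x`, with activation function `σ`. -/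
def NeuralNetwork.layer {p q l : ℕ} {w : ℕ → ℕ} (N : NeuralNetwork p q l w) (σ : ℝ → ℝ)
    (x : Euc p) : ∀ i, i ≤ l → Fin (layerSize p w i) → ℝ
  | 0, _ => fun k => x k
  | i + 1, h => fun j =>
      σ ((∑ k, N.A ⟨i, h⟩ j k * N.layer σ x i (Nat.le_of_succ_le h) k) + N.b ⟨i, h⟩ j)

/-- The function computed by the network. -/
def NeuralNetwork.eval {p q l : ℕ} {w : ℕ → ℕ} (N : NeuralNetwork p q l w) (σ : ℝ → ℝ)
    (x : Euc p) : Euc q :=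
  WithLp.toLp 2 fun j => (∑ k, N.Aout j k * N.layer σ x l le_rfl k) + N.bout j

/-! ### Wasserstein distance -/

/-- `γ` is a coupling of `μ` and `ν`. -/
def IsCoupling {n : ℕ} (γ : Measure (Euc n × Euc n)) (μ ν : Measure (Euc n)) : Prop :=
  γ.map Prod.fst = μ ∧ γ.map Prod.snd = ν

/-- The Wasserstein distance `W_p(μ, ν) = (inf_γ ∫ ‖x - y‖ᵖ dγ(x, y))^(1/p)`, with values in
`[0, ∞]`. -/
def wasserstein {n : ℕ} (p : ℝ) (μ ν : Measure (Euc n)) : ℝ≥0∞ :=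
  (⨅ (γ : Measure (Euc n × Euc n)) (_ : IsCoupling γ μ ν),
    ∫⁻ z, ENNReal.ofReal (‖z.1 - z.2‖ ^ p) ∂γ) ^ (1 / p)

end BarronNet

end

open BarronNet

/-! By Fourier inversion, a Barron function on `B` is a constant `a` plus a mixture, of total mass
at most 2C, of vectors ±d/2 with ‖d‖ ≤ 1 whose sign switches across a hyperplane. Normalised to a
probability measure, the atoms have norm at most C, so Maurey's sampling argument yields `r` of them
whose average has L² error at most C/√r. The atoms are bounded on the whole space, so the average
stays within C of `a` at every input: it differs from any value of f on `B` by at most 2C, even when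
it is fed a point far outside `B`.

The approximations are composed layer by layer. A layer costs ε in L²: ε/2 for sampling and ε/2 for
replacing steps by steep sigmoids. As the f_i are 1-Lipschitz, these errors add up. Since f_i is
Barron only near K_{i-1}, one keeps a set S of inputs on which the intermediate outputs stay within
s of the exact values; Chebyshev bounds the mass lost at layer i by (iε/s)². The last layer must
also be controlled off S, and there the uniform bound R = 2C√m applies. For l layers the squared
error is at most (lε - ε/2)² + R² Σ_{i<l} (iε/s)², which is strictly below the claim because Σ_{i<l}
i² ≤ l³/3.

The uniform bound belongs to the step network alone, as σ may leave [0, 1]. This is why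
`ShallowApprox` keeps the step network h apart from the sigmoidal one: in the last layer the passage
to σ is a separate L² error, chosen to fit into the strict gap. Feeding both maps the same X gives
the coupling.

Parts (a) and (b) differ only in the one-layer scheme; (b) samples every coordinate separately, to
precision ε/(2√m). -/

/-! ### Sampling in Hilbert space -/

/-- **Maurey's argument.** The mean of a bounded random function is approximated in `L²` by averages
of `r` of its values, which may be chosen off a given null set. -/
theorem exists_integral_norm_sum_sub_sq_le {Θ Ω V : Type*} [MeasurableSpace Θ] [MeasurableSpace Ω]
    [NormedAddCommGroup V] [InnerProductSpace ℝ V] [CompleteSpace V]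
    (P : Measure Θ) [IsProbabilityMeasure P] (ν : Measure Ω) [IsFiniteMeasure ν]
    (hν : ν.real Set.univ ≤ 1) {v : Θ → Ω → V} (hv : StronglyMeasurable (Function.uncurry v))
    {R : ℝ} (hR : ∀ θ x, ‖v θ x‖ ≤ R) {N : Set Θ} (hN : P N = 0) (r : ℕ) :
    ∃ θ : Fin r → Θ, (∀ k, θ k ∉ N) ∧
      ∫ x, ‖∑ k, (v (θ k) x - ∫ t, v t x ∂P)‖ ^ 2 ∂ν ≤ r * R ^ 2 := by
  have hFm : StronglyMeasurable fun x => ∫ t, v t x ∂P :=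
    StronglyMeasurable.integral_prod_left hv
  have hFb : ∀ x, ‖∫ t, v t x ∂P‖ ≤ R := fun x => by
    simpa using norm_integral_le_of_norm_le_const (μ := P) (ae_of_all _ fun t => hR t x)
  induction r with
  | zero => exact ⟨Fin.elim0, fun k => k.elim0, by simp⟩
  | succ r ih =>
    obtain ⟨θ, hθ, hle⟩ := ih
    set F : Ω → V := fun x => ∫ t, v t x ∂P with hF
    set T : Ω → V := fun x => ∑ k, (v (θ k) x - F x) with hT
    have hvθ : ∀ t, StronglyMeasurable (v t) := fun t => hv.comp_measurable measurable_prodMk_left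
    have hTm : StronglyMeasurable T := by
      refine Finset.stronglyMeasurable_fun_sum _ fun k _ => (hvθ _).sub hFm
    have hTb : ∀ x, ‖T x‖ ≤ r * (R + R) := fun x => by
      refine (norm_sum_le _ _).trans ?_
      refine (Finset.sum_le_sum (g := fun _ => R + R) fun k _ =>
        (norm_sub_le _ _).trans (add_le_add (hR _ _) (hFb x))).trans ?_
      simp [mul_add]
    have hΦ : Integrable (fun z : Θ × Ω => ‖T z.2 + (v z.1 z.2 - F z.2)‖ ^ 2) (P.prod ν) := by
      refine Integrable.of_bound (C := (r * (R + R) + (R + R)) ^ 2) ?_ (ae_of_all _ fun z => ?_)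
      · exact (((hTm.comp_measurable measurable_snd).add
          (hv.sub (hFm.comp_measurable measurable_snd))).norm.pow 2).aestronglyMeasurable
      · rw [Real.norm_of_nonneg (by positivity)]
        gcongr
        refine (norm_add_le _ _).trans (add_le_add (hTb _) ?_)
        exact (norm_sub_le _ _).trans (add_le_add (hR _ _) (hFb _))
    -- One sample at a time: some value off `N` does no worse than the average over `t`.
    obtain ⟨t, htN, ht⟩ := exists_notMem_null_le_integral hΦ.integral_prod_left hN
    refine ⟨Fin.snoc θ t, fun k => ?_, ?_⟩
    · refine Fin.lastCases ?_ (fun k => ?_) k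
      · simpa using htN
      · simpa using hθ k
    simp only [Fin.sum_univ_castSucc, Fin.snoc_castSucc, Fin.snoc_last]
    refine ht.trans ?_
    rw [integral_integral_swap hΦ]
    have hTi : Integrable (fun x => ‖T x‖ ^ 2) ν := by
      refine Integrable.of_bound (C := (r * (R + R)) ^ 2)
        (hTm.norm.pow 2).aestronglyMeasurable (ae_of_all _ fun x => ?_)
      rw [Real.norm_of_nonneg (by positivity)]
      gcongr
      exact hTb x
    have hpt : ∀ x, ∫ t, ‖T x + (v t x - F x)‖ ^ 2 ∂P ≤ ‖T x‖ ^ 2 + R ^ 2 := fun x => by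
      have hvx : StronglyMeasurable fun t => v t x := hv.comp_measurable measurable_prodMk_right
      have hvi : Integrable (fun t => v t x) P :=
        Integrable.of_bound hvx.aestronglyMeasurable R (ae_of_all _ fun t => hR t x)
      have hin : Integrable (fun t => inner ℝ (T x - F x) (v t x)) P := hvi.const_inner _
      have hle : ∀ t, ‖T x + (v t x - F x)‖ ^ 2
          ≤ ‖T x - F x‖ ^ 2 + 2 * inner ℝ (T x - F x) (v t x) + R ^ 2 := fun t => by
        -- With this grouping only `v` is random, and the mean square comes out as at most ‖T‖² -
        -- ‖F‖² + R².
        rw [show T x + (v t x - F x) = (T x - F x) + v t x by abel, norm_add_sq_real]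
        have := pow_le_pow_left₀ (norm_nonneg _) (hR t x) 2
        linarith
      have hi2 : Integrable (fun t => ‖T x - F x‖ ^ 2 + 2 * inner ℝ (T x - F x) (v t x) + R ^ 2) P :=
        ((integrable_const _).add (hin.const_mul 2)).add (integrable_const _)
      refine (integral_mono_of_nonneg (ae_of_all _ fun t => by positivity) hi2
        (ae_of_all _ hle)).trans ?_
      rw [integral_add (f := fun t => ‖T x - F x‖ ^ 2 + 2 * inner ℝ (T x - F x) (v t x))
          ((integrable_const _).add (hin.const_mul 2)) (integrable_const _),
        integral_add (integrable_const _) (hin.const_mul 2), integral_const_mul,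
        integral_inner hvi]
      simp only [integral_const, probReal_univ, one_smul]
      rw [norm_sub_sq_real, inner_sub_left, real_inner_self_eq_norm_sq]
      have : (0:ℝ) ≤ ‖F x‖ ^ 2 := by positivity
      change _ - _ + _ + 2 * (inner ℝ (T x) (F x) - _) + _ ≤ _
      linarith
    refine (integral_mono hΦ.integral_prod_right (hTi.add (integrable_const _)) hpt).trans ?_
    rw [integral_add' hTi (integrable_const _), integral_const, smul_eq_mul]
    push_cast
    have := mul_le_mul_of_nonneg_right hν (sq_nonneg R)
    linarith

/-! ### Fourier side: Barron functions as mixtures of centred steps -/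

namespace BarronNet

theorem continuous_fourierT {n : ℕ} {g : Euc n → ℝ} (hg : Integrable g) :
    Continuous (fourierT g) := by
  unfold fourierT
  refine continuous_const.mul ?_
  refine continuous_of_dominated (bound := fun x => ‖g x‖) (fun ω => ?_) (fun ω => ?_) hg.norm ?_
  · refine (Complex.continuous_ofReal.comp_aestronglyMeasurable hg.aestronglyMeasurable).mul ?_
    exact Continuous.aestronglyMeasurable (by fun_prop)
  · refine ae_of_all _ fun x => ?_
    rw [norm_mul, ← mul_neg, mul_comm Complex.I, ← Complex.ofReal_neg, Complex.norm_exp_ofReal_mul_I]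
    simp
  · exact ae_of_all _ fun x => by fun_prop

theorem continuous_fourierVec {n m : ℕ} {g : Euc n → Euc m}
    (hg : ∀ j, Integrable fun x => g x j) : Continuous (fourierVec g) :=
  (PiLp.continuous_toLp 2 _).comp (continuous_pi fun j => continuous_fourierT (hg j))

section dualNorm

variable {n : ℕ} {B : Set (Euc n)}

theorem bddAbove_abs_inner_image (hB : Bornology.IsBounded B) (ω : Euc n) :
    BddAbove ((fun x => |(inner ℝ ω x : ℝ)|) '' B) := by
  obtain ⟨R, hR⟩ := hB.exists_norm_le
  refine ⟨‖ω‖ * R, ?_⟩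
  rintro _ ⟨x, hx, rfl⟩
  exact (abs_real_inner_le_norm _ _).trans (by gcongr; exact hR x hx)

theorem abs_inner_le_dualNorm (hB : Bornology.IsBounded B) (ω : Euc n) {x : Euc n} (hx : x ∈ B) :
    |(inner ℝ ω x : ℝ)| ≤ dualNorm B ω :=
  le_csSup (bddAbove_abs_inner_image hB ω) ⟨x, hx, rfl⟩

theorem dualNorm_nonneg (ω : Euc n) : 0 ≤ dualNorm B ω := by
  apply Real.sSup_nonneg
  rintro _ ⟨x, -, rfl⟩
  exact abs_nonneg _

/-- The supremum may be uncountable, but suprema of continuous functions are lower semicontinuous.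
-/
theorem measurable_dualNorm (hB : Bornology.IsBounded B) : Measurable (dualNorm B) := by
  have : dualNorm B = fun ω => ⨆ x : B, |(inner ℝ ω x.1 : ℝ)| := by
    funext ω
    rw [dualNorm, sSup_image']
  rw [this]
  refine (lowerSemicontinuous_ciSup (fun ω => ?_) fun x =>
    Continuous.lowerSemicontinuous (by fun_prop)).measurable
  simpa only [Set.image_eq_range] using bddAbove_abs_inner_image hB ω

end dualNorm

/-- On `[-w, w]` the function `τ ↦ Re (e^{iτ} z)` is, up to a constant, a mixture of centred step
functions. -/
theorem intervalIntegral_step_mul_exp {τ w : ℝ} (hτ : |τ| ≤ w) (z : ℂ) :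
    ∫ u in (-w)..w, ((if u < τ then 1 else 0) - 1 / 2 : ℝ) *
        (Complex.I * Complex.exp (Complex.I * u) * z).re
      = ((Complex.exp (Complex.I * τ) - Real.cos w) * z).re := by
  obtain ⟨h1, h2⟩ := abs_le.mp hτ
  set G : ℝ → ℝ := fun u => (Complex.exp (Complex.I * u) * z).re with hG
  set G' : ℝ → ℝ := fun u => (Complex.I * Complex.exp (Complex.I * u) * z).re with hG'
  have hd : ∀ u : ℝ, HasDerivAt G (G' u) u := fun u => by
    have e1 : HasDerivAt (fun u : ℂ => Complex.exp (Complex.I * u) * z)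
        (Complex.I * Complex.exp (Complex.I * u) * z) (u : ℂ) := by
      have := (((hasDerivAt_id (u : ℂ)).const_mul Complex.I).cexp).mul_const z
      simpa [mul_comm Complex.I (Complex.exp _)] using this
    exact e1.real_of_complex
  have hc : Continuous G' := by
    simp only [hG']; fun_prop
  have hi : ∀ a b, IntervalIntegrable G' volume a b := fun a b => hc.intervalIntegrable a b
  have hI : ∀ a b, ∫ u in a..b, G' u = G b - G a := fun a b =>
    intervalIntegral.integral_eq_sub_of_hasDerivAt (fun u _ => hd u) (hi a b)
  have hL : Set.EqOn (fun u => (1 / 2 : ℝ) * G' u)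
      (fun u => ((if u < τ then 1 else 0) - 1 / 2 : ℝ) * G' u) (Set.Ioo (-w) τ) := fun u hu => by
    simp only [if_pos hu.2]; ring
  have hR : Set.EqOn (fun u => (-(1 / 2) : ℝ) * G' u)
      (fun u => ((if u < τ then 1 else 0) - 1 / 2 : ℝ) * G' u) (Set.Ioo τ w) := fun u hu => by
    simp only [if_neg hu.1.not_gt]; ring
  have iL : IntervalIntegrable (fun u => ((if u < τ then 1 else 0) - 1 / 2 : ℝ) * G' u)
      volume (-w) τ := by
    rw [intervalIntegrable_iff_integrableOn_Ioo_of_le h1]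
    refine IntegrableOn.congr_fun ?_ hL measurableSet_Ioo
    exact (intervalIntegrable_iff_integrableOn_Ioo_of_le h1).mp ((hi _ _).const_mul _)
  have iR : IntervalIntegrable (fun u => ((if u < τ then 1 else 0) - 1 / 2 : ℝ) * G' u)
      volume τ w := by
    rw [intervalIntegrable_iff_integrableOn_Ioo_of_le h2]
    refine IntegrableOn.congr_fun ?_ hR measurableSet_Ioo
    exact (intervalIntegrable_iff_integrableOn_Ioo_of_le h2).mp ((hi _ _).const_mul _)
  have eL : ∫ u in (-w)..τ, ((if u < τ then 1 else 0) - 1 / 2 : ℝ) * G' u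
      = 1 / 2 * (G τ - G (-w)) := by
    rw [← hI, ← intervalIntegral.integral_const_mul, intervalIntegral.integral_of_le h1,
      intervalIntegral.integral_of_le h1, integral_Ioc_eq_integral_Ioo,
      integral_Ioc_eq_integral_Ioo]
    exact (setIntegral_congr_fun measurableSet_Ioo hL).symm
  have eR : ∫ u in τ..w, ((if u < τ then 1 else 0) - 1 / 2 : ℝ) * G' u
      = -(1 / 2) * (G w - G τ) := by
    rw [← hI, ← intervalIntegral.integral_const_mul, intervalIntegral.integral_of_le h2,
      intervalIntegral.integral_of_le h2, integral_Ioc_eq_integral_Ioo,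
      integral_Ioc_eq_integral_Ioo]
    exact (setIntegral_congr_fun measurableSet_Ioo hR).symm
  -- The two pieces sum to G(τ) - (G(w) + G(-w))/2, and averaging e^{iw} with e^{-iw} gives cos w.
  rw [← intervalIntegral.integral_add_adjacent_intervals iL iR, eL, eR]
  have hcos : (Real.cos w : ℂ) = (Complex.exp (Complex.I * w) + Complex.exp (Complex.I * (-w : ℝ))) / 2 := by
    rw [Complex.ofReal_cos, Complex.cos]
    push_cast
    congr 3 <;> ring_nf
  have : ((Complex.exp (Complex.I * τ) - Real.cos w) * z)
      = Complex.exp (Complex.I * τ) * z - ((1 / 2 : ℝ) : ℂ) * (Complex.exp (Complex.I * w) * z)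
        - ((1 / 2 : ℝ) : ℂ) * (Complex.exp (Complex.I * (-w : ℝ)) * z) := by
    rw [hcos]; push_cast; ring
  rw [this, Complex.sub_re, Complex.sub_re, Complex.re_ofReal_mul, Complex.re_ofReal_mul]
  simp only [hG]
  ring

/-- The centred step function with jump across the hyperplane `⟨ω, y⟩ = u`, where `θ = (ω, u)`. -/
noncomputable def centredStep {n : ℕ} (θ : Euc n × ℝ) (y : Euc n) : ℝ :=
  (if θ.2 < inner ℝ θ.1 y then 1 else 0) - 1 / 2

theorem abs_centredStep {n : ℕ} (θ : Euc n × ℝ) (y : Euc n) : |centredStep θ y| = 1 / 2 := by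
  unfold centredStep
  split_ifs
  · norm_num
  · norm_num [abs_of_neg]

theorem measurable_centredStep {n : ℕ} :
    Measurable fun z : (Euc n × ℝ) × Euc n => centredStep z.1 z.2 := by
  unfold centredStep
  refine Measurable.sub_const (Measurable.ite ?_ measurable_const measurable_const) _
  exact measurableSet_lt (by fun_prop) (Continuous.measurable (by fun_prop))

/-- **Barron's theorem, integral form.** A Barron function is, on `B`, a constant plus a mixture
of centred step functions of total mass at most `2C`. -/
theorem IsBarronVec.exists_integral_centredStep {n m : ℕ} {B : Set (Euc n)} {C : ℝ}
    {f : Euc n → Euc m} (hB : Bornology.IsBounded B) (h : IsBarronVec B C f) :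
    0 ≤ C ∧ ∃ (Q : Measure (Euc n × ℝ)) (d : Euc n × ℝ → Euc m) (a : Euc m),
      Q ≪ volume ∧ Q Set.univ ≤ ENNReal.ofReal (2 * C) ∧ Measurable d ∧ (∀ θ, ‖d θ‖ ≤ 1) ∧
      ∀ y ∈ B, f y = a + ∫ θ, centredStep θ y • d θ ∂Q := by
  obtain ⟨g, hgf, hinv, hint, hC⟩ := h
  refine ⟨(integral_nonneg fun ω => mul_nonneg (dualNorm_nonneg ω) (norm_nonneg _)).trans hC, ?_⟩
  set G : Euc n → EuclideanSpace ℂ (Fin m) := fourierVec g with hG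
  have hGc : Continuous G := continuous_fourierVec fun j => (hinv j).1
  set w : Euc n → ℝ := dualNorm B with hw
  have hwm : Measurable w := measurable_dualNorm hB
  have hw0 : ∀ ω, 0 ≤ w ω := fun ω => dualNorm_nonneg ω
  set T : Set (Euc n × ℝ) := {θ | θ.2 ∈ Set.Ioc (-w θ.1) (w θ.1)} with hT
  have hTm : MeasurableSet T :=
    (measurableSet_lt (hwm.comp measurable_fst).neg measurable_snd).inter
      (measurableSet_le measurable_snd (hwm.comp measurable_fst))
  -- Over each ω the strip `T` has length 2‖ω‖_B, so this density has mass 2∫ ‖ω‖_B ‖ĝ(ω)‖ dω ≤ 2C.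
  set φ : Euc n × ℝ → NNReal := T.indicator fun θ => ‖G θ.1‖₊ with hφ
  have hφm : Measurable φ :=
    (hGc.comp continuous_fst).nnnorm.measurable.indicator hTm
  set e : Euc n × ℝ → Euc m := fun θ => WithLp.toLp 2 fun j =>
    (Complex.I * Complex.exp (Complex.I * θ.2) * G θ.1 j).re with he
  have hec : Continuous e := by
    refine (PiLp.continuous_toLp 2 _).comp (continuous_pi fun j => ?_)
    have : Continuous fun θ : Euc n × ℝ => G θ.1 j :=
      (EuclideanSpace.proj (𝕜 := ℂ) j).continuous.comp (hGc.comp continuous_fst)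
    fun_prop
  have heb : ∀ θ, ‖e θ‖ ≤ ‖G θ.1‖ := fun θ => by
    rw [EuclideanSpace.norm_eq, EuclideanSpace.norm_eq]
    refine Real.sqrt_le_sqrt (Finset.sum_le_sum fun j _ => ?_)
    gcongr
    refine (Complex.abs_re_le_norm _).trans ?_
    rw [norm_mul, norm_mul, mul_comm Complex.I, Complex.norm_exp_ofReal_mul_I]
    simp
  -- Where G = 0 the inverse is 0 by convention; this is harmless since e vanishes there too.
  set d : Euc n × ℝ → Euc m := fun θ => ‖G θ.1‖⁻¹ • e θ with hd
  have hdm : Measurable d :=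
    (hGc.comp continuous_fst).norm.measurable.inv.smul hec.measurable
  have hdb : ∀ θ, ‖d θ‖ ≤ 1 := fun θ => by
    rw [hd, norm_smul, norm_inv, norm_norm]
    exact (mul_le_mul_of_nonneg_left (heb θ) (by positivity)).trans inv_mul_le_one
  have hmass : (∫⁻ θ, φ θ ∂(volume : Measure (Euc n × ℝ))) ≤ ENNReal.ofReal (2 * C) := by
    rw [Measure.volume_eq_prod, lintegral_prod _ hφm.coe_nnreal_ennreal.aemeasurable]
    have : ∀ ω, ∫⁻ u, (φ (ω, u) : ℝ≥0∞) = ENNReal.ofReal (2 * (w ω * ‖G ω‖)) := fun ω => by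
      have h1 : ∀ u, (φ (ω, u) : ℝ≥0∞)
          = (Set.Ioc (-w ω) (w ω)).indicator (fun _ => (‖G ω‖₊ : ℝ≥0∞)) u := fun u => by
        by_cases hu : u ∈ Set.Ioc (-w ω) (w ω)
        · have : (ω, u) ∈ T := hu
          simp only [hφ, Set.indicator_of_mem hu, Set.indicator_of_mem this]
        · have : (ω, u) ∉ T := hu
          simp only [hφ, Set.indicator_of_notMem hu, Set.indicator_of_notMem this,
            ENNReal.coe_zero]
      simp_rw [h1]
      rw [lintegral_indicator_const measurableSet_Ioc, Real.volume_Ioc, ← enorm_eq_nnnorm,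
        ← ofReal_norm, ← ENNReal.ofReal_mul (norm_nonneg _)]
      congr 1; ring
    simp_rw [this]
    rw [← ofReal_integral_eq_lintegral_ofReal (hint.const_mul 2)
      (ae_of_all _ fun ω => mul_nonneg zero_le_two (mul_nonneg (hw0 ω) (norm_nonneg _))),
      integral_const_mul]
    exact ENNReal.ofReal_le_ofReal (by linarith)
  set Q : Measure (Euc n × ℝ) := volume.withDensity fun θ => φ θ with hQ
  have hQu : Q Set.univ ≤ ENNReal.ofReal (2 * C) := by
    rw [hQ, withDensity_apply _ MeasurableSet.univ, Measure.restrict_univ]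
    exact hmass
  have : IsFiniteMeasure Q := ⟨hQu.trans_lt ENNReal.ofReal_lt_top⟩
  -- Inversion involves e^{iτ} - 1 while centred steps produce e^{iτ} - cos w. The constant absorbs
  -- the difference, integrable because |cos w - 1| ≤ w.
  set a : Euc m := WithLp.toLp 2 fun j =>
    g 0 j + (∫ ω, ((Real.cos (w ω) : ℂ) - 1) * G ω j).re with ha
  refine ⟨Q, d, a, withDensity_absolutelyContinuous _ _, hQu, hdm, hdb, fun y hy => ?_⟩
  have hvm : Measurable fun θ => centredStep θ y • d θ :=
    (measurable_centredStep.comp (measurable_id.prodMk measurable_const)).smul hdm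
  have hvi : Integrable (fun θ => centredStep θ y • d θ) Q := by
    refine Integrable.of_bound hvm.aestronglyMeasurable (1 / 2) (ae_of_all _ fun θ => ?_)
    rw [norm_smul, Real.norm_eq_abs, abs_centredStep]
    have := hdb θ
    linarith
  have hcosi : ∀ j, Integrable fun ω => ((Real.cos (w ω) : ℂ) - 1) * G ω j := fun j => by
    refine Integrable.mono' hint ?_ (ae_of_all _ fun ω => ?_)
    · refine Measurable.aestronglyMeasurable ?_
      have : Continuous fun ω => G ω j := (EuclideanSpace.proj (𝕜 := ℂ) j).continuous.comp hGc
      have h2 := this.measurable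
      have h3 : Measurable fun ω => Real.cos (w ω) := Real.measurable_cos.comp hwm
      fun_prop
    · rw [norm_mul]
      refine mul_le_mul ?_ (PiLp.norm_apply_le _ _) (norm_nonneg _) (hw0 ω)
      rw [← Complex.ofReal_one, ← Complex.ofReal_sub, Complex.norm_real, Real.norm_eq_abs]
      have := Real.abs_cos_sub_cos_le (w ω) 0
      simpa [abs_of_nonneg (hw0 ω)] using this
  ext j
  have hj1 : (∫ θ, centredStep θ y • d θ ∂Q) j = ∫ θ, centredStep θ y * d θ j ∂Q := by
    have := (EuclideanSpace.proj (𝕜 := ℝ) j).integral_comp_comm hvi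
    simpa using this.symm
  rw [PiLp.add_apply, hj1]
  have hji : Integrable (fun θ => centredStep θ y * d θ j) Q := by
    simpa using (EuclideanSpace.proj (𝕜 := ℝ) j).integrable_comp hvi
  have hφd : ∀ θ, φ θ • (centredStep θ y * d θ j)
      = T.indicator (fun θ => centredStep θ y * e θ j) θ := fun θ => by
    by_cases hθ : θ ∈ T
    · simp only [hφ, Set.indicator_of_mem hθ, hd, PiLp.smul_apply, NNReal.smul_def, smul_eq_mul,
        coe_nnnorm]
      by_cases h0 : ‖G θ.1‖ = 0
      · have h1 : ‖e θ‖ = 0 := le_antisymm (h0 ▸ heb θ) (norm_nonneg _)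
        rw [norm_eq_zero.mp h1]; simp
      · field_simp
    · simp only [hφ, Set.indicator_of_notMem hθ, zero_smul]
  have hji' := (integrable_withDensity_iff_integrable_smul hφm).mp hji
  rw [hQ, integral_withDensity_eq_integral_smul hφm]
  simp_rw [hφd] at hji' ⊢
  rw [Measure.volume_eq_prod] at hji' ⊢
  rw [integral_prod _ hji']
  have hinner : ∀ ω, ∫ u, T.indicator (fun θ => centredStep θ y * e θ j) (ω, u)
      = ((Complex.exp (Complex.I * (inner ℝ ω y : ℝ)) - Real.cos (w ω)) * G ω j).re := fun ω => by
    rw [← intervalIntegral_step_mul_exp (w := w ω) (abs_inner_le_dualNorm hB ω hy),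
      intervalIntegral.integral_of_le (by have := hw0 ω; linarith),
      ← integral_indicator measurableSet_Ioc]
    refine integral_congr_ae (ae_of_all _ fun u => ?_)
    by_cases hu : u ∈ Set.Ioc (-w ω) (w ω)
    · have : (ω, u) ∈ T := hu
      simp only [Set.indicator_of_mem hu, Set.indicator_of_mem this]
      rfl
    · have : (ω, u) ∉ T := hu
      simp only [Set.indicator_of_notMem hu, Set.indicator_of_notMem this]
  simp_rw [hinner]
  obtain ⟨hei, hgy⟩ := (hinv j).2 y hy
  have hsub : ∀ ω, (Complex.exp (Complex.I * (inner ℝ ω y : ℝ)) - Real.cos (w ω)) * G ω j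
      = (Complex.exp (Complex.I * (inner ℝ ω y : ℝ)) - 1) * fourierT (fun x => g x j) ω
        - ((Real.cos (w ω) : ℂ) - 1) * G ω j := fun ω => by
    have : fourierT (fun x => g x j) ω = G ω j := rfl
    rw [this]; ring
  simp_rw [hsub]
  have hre := Complex.reCLM.integral_comp_comm (hei.sub (hcosi j))
  simp only [Complex.reCLM_apply, Pi.sub_apply] at hre
  rw [hre, integral_sub hei (hcosi j), Complex.sub_re, ← hgf hy]
  have h3 := congrArg Complex.re hgy
  rw [Complex.add_re, Complex.ofReal_re, Complex.ofReal_re] at h3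
  refine h3.trans ?_
  simp only [ha]
  ring

end BarronNet

/-! ### Step networks and Barron's theorem in L² -/

theorem eLpNorm_two_le_iff {α E : Type*} [MeasurableSpace α] [NormedAddCommGroup E] {μ : Measure α}
    {f : α → E} {c : ℝ≥0∞} : eLpNorm f 2 μ ≤ c ↔ ∫⁻ x, ‖f x‖ₑ ^ 2 ∂μ ≤ c ^ 2 := by
  rw [eLpNorm_eq_lintegral_rpow_enorm_toReal two_ne_zero ENNReal.ofNat_ne_top, one_div,
    ENNReal.rpow_inv_le_iff (by simp)]
  simp

namespace BarronNet

/-- A network with one hidden layer whose `k`-th node is the step function that jumps across the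
hyperplane `⟨(θ k).1, y⟩ = (θ k).2`. -/
noncomputable def stepNet {n m r : ℕ} (θ : Fin r → Euc n × ℝ) (c : Fin r → Euc m) (b : Euc m)
    (y : Euc n) : Euc m :=
  b + ∑ k, (if (θ k).2 < inner ℝ (θ k).1 y then 1 else 0 : ℝ) • c k

theorem measurable_stepNet {n m r : ℕ} (θ : Fin r → Euc n × ℝ) (c : Fin r → Euc m) (b : Euc m) :
    Measurable (stepNet θ c b) := by
  unfold stepNet
  refine measurable_const.add (Finset.measurable_fun_sum _ fun k _ => Measurable.smul_const ?_ _)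
  exact Measurable.ite (measurableSet_lt measurable_const (Continuous.measurable (by fun_prop)))
    measurable_const measurable_const

/-- The centring by 1/2 is paid for by the output bias, so centred atoms cost no extra node. -/
theorem stepNet_eq_centredStep {n m r : ℕ} (θ : Fin r → Euc n × ℝ) (c : Fin r → Euc m) (a : Euc m)
    (y : Euc n) :
    stepNet θ c (a - (1 / 2 : ℝ) • ∑ k, c k) y = a + ∑ k, centredStep (θ k) y • c k := by
  simp only [stepNet, centredStep, sub_smul, Finset.sum_sub_distrib, Finset.smul_sum]
  abel

/-- Almost every hyperplane is a null set for the law of `Y`. -/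
theorem ae_measure_inner_eq_zero {Ω : Type*} [MeasurableSpace Ω] {n : ℕ} (μ : Measure Ω)
    [IsFiniteMeasure μ] {Y : Ω → Euc n} (hY : Measurable Y) :
    ∀ᵐ θ : Euc n × ℝ, ∀ᵐ x ∂μ, inner ℝ θ.1 (Y x) ≠ θ.2 := by
  have hE : MeasurableSet {z : (Euc n × ℝ) × Ω | inner ℝ z.1.1 (Y z.2) ≠ z.1.2} := by
    have h1 : Measurable fun z : (Euc n × ℝ) × Ω => (inner ℝ z.1.1 (Y z.2) : ℝ) :=
      Measurable.inner (by fun_prop) (by fun_prop)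
    exact (measurableSet_eq_fun h1 (by fun_prop)).compl
  -- By Fubini it suffices to fix x; then for each ω exactly one u is bad.
  rw [Measure.ae_ae_comm hE]
  refine ae_of_all _ fun x => ?_
  have hm : MeasurableSet {θ : Euc n × ℝ | inner ℝ θ.1 (Y x) = θ.2} :=
    measurableSet_eq_fun (Continuous.measurable (by fun_prop)) (by fun_prop)
  have : (volume : Measure (Euc n × ℝ)) {θ : Euc n × ℝ | inner ℝ θ.1 (Y x) = θ.2} = 0 := by
    rw [Measure.volume_eq_prod, Measure.measure_prod_null hm]
    refine ae_of_all _ fun ω => ?_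
    have : (Prod.mk ω ⁻¹' {θ : Euc n × ℝ | inner ℝ θ.1 (Y x) = θ.2}) = {inner ℝ ω (Y x)} := by
      ext u; simp [eq_comm]
    simp only [this, Real.volume_singleton, Pi.zero_apply]
  rw [ae_iff]
  simpa using this

/-- An average of r atoms of norm M/2 has squared error at most (M/2)²/r. The 1/2 gained by centring
cancels the 2 in the mass bound 2C. -/
theorem inv_sq_mul_le_of_le_mul_sq {r M C η I : ℝ} (hr : 0 < r) (hM : 0 ≤ M) (hMC : M ≤ 2 * C)
    (hC : C ^ 2 ≤ η ^ 2 * r) (hI : I ≤ r * (M / 2) ^ 2) : r⁻¹ ^ 2 * I ≤ η ^ 2 := by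
  calc r⁻¹ ^ 2 * I ≤ r⁻¹ ^ 2 * (r * (M / 2) ^ 2) := by gcongr
    _ = (M / 2) ^ 2 / r := by field_simp
    _ ≤ C ^ 2 / r := by gcongr; linarith
    _ ≤ η ^ 2 := by rwa [div_le_iff₀ hr]

set_option maxHeartbeats 400000 in
/-- **Barron's theorem** for step networks, with control of the output on the whole space. -/
theorem IsBarronVec.exists_stepNet {Ω : Type*} [MeasurableSpace Ω] {n m : ℕ} {B : Set (Euc n)}
    {C : ℝ} {f : Euc n → Euc m} (hB : Bornology.IsBounded B) (hf : IsBarronVec B C f)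
    (μ : Measure Ω) [IsProbabilityMeasure μ] {Y : Ω → Euc n} (hY : Measurable Y) {S : Set Ω}
    (hS : MeasurableSet S) (hYS : ∀ x ∈ S, Y x ∈ B) (r : ℕ) {η : ℝ} (hr : C ^ 2 ≤ η ^ 2 * r) :
    ∃ (θ : Fin r → Euc n × ℝ) (c : Fin r → Euc m) (b : Euc m),
      (∀ k, ∀ᵐ x ∂μ, inner ℝ (θ k).1 (Y x) ≠ (θ k).2) ∧
      eLpNorm (fun x => f (Y x) - stepNet θ c b (Y x)) 2 (μ.restrict S) ≤ ENNReal.ofReal |η| ∧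
      ∀ y ∈ B, ∀ z, ‖f y - stepNet θ c b z‖ ≤ 2 * C := by
  obtain ⟨hC, Q, d, a, hQv, hQu, hdm, hdb, hrep⟩ := hf.exists_integral_centredStep hB
  have : IsFiniteMeasure Q := ⟨hQu.trans_lt ENNReal.ofReal_lt_top⟩
  set M : ℝ := Q.real Set.univ with hM
  have hM0 : 0 ≤ M := measureReal_nonneg
  have hMC : M ≤ 2 * C := ENNReal.toReal_le_of_le_ofReal (by positivity) hQu
  rcases eq_or_ne Q 0 with hQ0 | hQ0
  -- A zero measure cannot be normalised, but then f is constant on `B`. The parameter (0, 1)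
  -- describes the empty hyperplane 0 = 1.
  · refine ⟨fun _ => (0, 1), fun _ => 0, a, fun k => ae_of_all _ fun x => by simp, ?_, ?_⟩
    · rw [eLpNorm_two_le_iff]
      have : ∫⁻ x in S, ‖f (Y x) - stepNet (fun _ : Fin r => (0, 1)) (fun _ => 0) a (Y x)‖ₑ ^ 2 ∂μ
          = ∫⁻ x in S, 0 ∂μ := by
        refine setLIntegral_congr_fun hS fun x hx => ?_
        simp [hrep _ (hYS x hx), hQ0, stepNet]
      rw [this]; simp
    · intro y hy z
      simp [hrep y hy, hQ0, stepNet, hC]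
  have hMpos : 0 < M := by
    rw [hM, measureReal_def]
    exact ENNReal.toReal_pos (by simpa using hQ0) (measure_ne_top _ _)
  -- If r = 0 then C = 0, contradicting 0 < M ≤ 2C.
  have hr0 : 0 < (r : ℝ) := by
    rcases Nat.eq_zero_or_pos r with rfl | h
    · simp only [Nat.cast_zero, mul_zero] at hr
      nlinarith
    · exact_mod_cast h
  set P : Measure (Euc n × ℝ) := (Q Set.univ)⁻¹ • Q with hP
  have : NeZero Q := ⟨hQ0⟩
  have hPi : ∀ y, ∫ θ, M • centredStep θ y • d θ ∂P = ∫ θ, centredStep θ y • d θ ∂Q := fun y => by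
    rw [integral_smul, hP, integral_smul_measure, smul_smul, ENNReal.toReal_inv]
    change (M * M⁻¹) • _ = _
    rw [mul_inv_cancel₀ hMpos.ne', one_smul]
  -- Hyperplanes charged by the law of Y are excluded from sampling, since steep sigmoids are
  -- uncontrolled on the jump.
  have hPN : P {θ | ¬ ∀ᵐ x ∂μ, inner ℝ θ.1 (Y x) ≠ θ.2} = 0 := by
    rw [hP, Measure.smul_apply, hQv (ae_iff.mp (ae_measure_inner_eq_zero μ hY)), smul_zero]
  have hvm : StronglyMeasurable (Function.uncurry fun (θ : Euc n × ℝ) (x : Ω) =>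
      M • centredStep θ (Y x) • d θ) := by
    have h1 : Measurable fun z : (Euc n × ℝ) × Ω => centredStep z.1 (Y z.2) :=
      measurable_centredStep.comp (measurable_fst.prodMk (hY.comp measurable_snd))
    exact ((h1.smul (hdm.comp measurable_fst)).const_smul M).stronglyMeasurable
  have hvθ : ∀ θ, StronglyMeasurable fun x => M • centredStep θ (Y x) • d θ :=
    fun θ => hvm.comp_measurable measurable_prodMk_left
  have hvb : ∀ (θ : Euc n × ℝ) (y : Euc n), ‖M • centredStep θ y • d θ‖ ≤ M / 2 := fun θ y => by
    rw [norm_smul, norm_smul, Real.norm_eq_abs, Real.norm_eq_abs, abs_centredStep,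
      abs_of_nonneg hM0]
    have := mul_le_mul_of_nonneg_left (hdb θ) hM0
    linarith
  have hν : (μ.restrict S).real Set.univ ≤ 1 := by
    rw [measureReal_restrict_apply_univ]
    exact measureReal_le_one
  obtain ⟨θ, hθN, hθ⟩ := exists_integral_norm_sum_sub_sq_le P (μ.restrict S) hν hvm
    (fun θ x => hvb θ (Y x)) hPN r
  simp_rw [hPi] at hθ
  set c : Fin r → Euc m := fun k => (r : ℝ)⁻¹ • M • d (θ k) with hc
  have hFm : StronglyMeasurable fun x => ∫ t, centredStep t (Y x) • d t ∂Q := by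
    simp_rw [← hPi]
    exact StronglyMeasurable.integral_prod_left hvm
  have hFb : ∀ y, ‖∫ t, centredStep t y • d t ∂Q‖ ≤ M / 2 := fun y => by
    rw [← hPi]
    simpa using norm_integral_le_of_norm_le_const (μ := P) (ae_of_all _ fun t => hvb t y)
  have hck : ∀ z k, centredStep (θ k) z • c k = (r : ℝ)⁻¹ • (M • centredStep (θ k) z • d (θ k)) :=
    fun z k => by
      simp only [hc, smul_smul]; congr 1; ring
  refine ⟨θ, c, a - (1 / 2 : ℝ) • ∑ k, c k, fun k => not_not.mp (hθN k), ?_, fun y hy z => ?_⟩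
  · rw [eLpNorm_two_le_iff]
    have e1 : ∫⁻ x in S, ‖f (Y x) - stepNet θ c (a - (1 / 2 : ℝ) • ∑ k, c k) (Y x)‖ₑ ^ 2 ∂μ
        = ∫⁻ x in S, ENNReal.ofReal ((r : ℝ)⁻¹ ^ 2 * ‖∑ k, (M • centredStep (θ k) (Y x) • d (θ k)
          - ∫ t, centredStep t (Y x) • d t ∂Q)‖ ^ 2) ∂μ := by
      refine setLIntegral_congr_fun hS fun x hx => ?_
      have : f (Y x) - stepNet θ c (a - (1 / 2 : ℝ) • ∑ k, c k) (Y x)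
          = -((r : ℝ)⁻¹ • ∑ k, (M • centredStep (θ k) (Y x) • d (θ k)
            - ∫ t, centredStep t (Y x) • d t ∂Q)) := by
        rw [stepNet_eq_centredStep, hrep _ (hYS x hx), Finset.sum_sub_distrib, smul_sub,
          Finset.sum_const, Finset.card_univ, Fintype.card_fin, ← Nat.cast_smul_eq_nsmul ℝ,
          smul_smul, inv_mul_cancel₀ hr0.ne', one_smul]
        simp_rw [hck, ← Finset.smul_sum]
        abel
      simp only [this]
      rw [enorm_neg, ← ofReal_norm, ← ENNReal.ofReal_pow (norm_nonneg _), norm_smul, mul_pow,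
        Real.norm_of_nonneg (by positivity)]
    have hint : Integrable (fun x => ‖∑ k, (M • centredStep (θ k) (Y x) • d (θ k)
          - ∫ t, centredStep t (Y x) • d t ∂Q)‖ ^ 2) (μ.restrict S) := by
      refine Integrable.of_bound ?_ ((r * (M / 2 + M / 2)) ^ 2) (ae_of_all _ fun x => ?_)
      · refine (StronglyMeasurable.pow (StronglyMeasurable.norm ?_) 2).aestronglyMeasurable
        refine Finset.stronglyMeasurable_fun_sum _ fun k _ => (hvθ _).sub hFm
      · rw [Real.norm_of_nonneg (by positivity)]
        gcongr
        refine (norm_sum_le_of_le (n := fun _ => M / 2 + M / 2) Finset.univ fun k _ =>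
          (norm_sub_le _ _).trans (add_le_add (hvb _ _) (hFb _))).trans ?_
        simp
    rw [e1, ← ofReal_integral_eq_lintegral_ofReal (hint.const_mul _)
      (ae_of_all _ fun x => by positivity), integral_const_mul,
      ← ENNReal.ofReal_pow (abs_nonneg _), sq_abs]
    refine ENNReal.ofReal_le_ofReal ?_
    exact inv_sq_mul_le_of_le_mul_sq hr0 hM0 hMC hr hθ
  -- Both values lie within M/2 of `a`; for the network this needs nothing of z.
  · rw [stepNet_eq_centredStep, hrep y hy, add_sub_add_left_eq_sub]
    refine (norm_sub_le _ _).trans ?_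
    have : ‖∑ k, centredStep (θ k) z • c k‖ ≤ M / 2 := by
      have e : ∑ k, centredStep (θ k) z • c k
          = (r : ℝ)⁻¹ • ∑ k, (M • centredStep (θ k) z • d (θ k)) := by
        rw [Finset.smul_sum]
        exact Finset.sum_congr rfl fun k _ => hck z k
      rw [e, norm_smul, norm_inv, Real.norm_of_nonneg hr0.le, inv_mul_le_iff₀ hr0]
      refine (norm_sum_le_of_le (f := fun k => M • centredStep (θ k) z • d (θ k))
        (n := fun _ => M / 2) Finset.univ fun k _ => hvb (θ k) z).trans ?_
      simp
    have := hFb y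
    linarith

/-! ### From steps to sigmoids -/

/-- The function computed by a network with one hidden layer. -/
noncomputable def shallowNet (σ : ℝ → ℝ) {n m r : ℕ} (A : Matrix (Fin r) (Fin n) ℝ) (β : Fin r → ℝ)
    (Ao : Matrix (Fin m) (Fin r) ℝ) (bo : Fin m → ℝ) (y : Euc n) : Euc m :=
  WithLp.toLp 2 fun j => (∑ k, Ao j k * σ ((∑ i, A k i * y i) + β k)) + bo j

/-- Steep sigmoidal functions approximate step functions off the jumps. -/
theorem IsSigmoidal.tendsto_step {σ : ℝ → ℝ} (hσ : IsSigmoidal σ) {τ u : ℝ} (h : τ ≠ u) :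
    Tendsto (fun N : ℕ => σ (N * (τ - u))) atTop (𝓝 (if u < τ then 1 else 0)) := by
  split_ifs with hu
  · exact hσ.tendsto_atTop.comp
      (tendsto_natCast_atTop_atTop.atTop_mul_const (sub_pos.mpr hu))
  · exact hσ.tendsto_atBot.comp (tendsto_natCast_atTop_atTop.atTop_mul_const_of_neg
      (sub_neg.mpr (lt_of_le_of_ne (not_lt.mp hu) h)))

/-- A step network is approximated in `L²` by networks with a sigmoidal activation function. -/
theorem IsSigmoidal.exists_shallowNet {Ω : Type*} [MeasurableSpace Ω] {σ : ℝ → ℝ}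
    (hσ : IsSigmoidal σ) (μ : Measure Ω) [IsFiniteMeasure μ] {n m r : ℕ} {Y : Ω → Euc n}
    (hY : Measurable Y) (θ : Fin r → Euc n × ℝ) (c : Fin r → Euc m) (b : Euc m)
    (hθ : ∀ k, ∀ᵐ x ∂μ, inner ℝ (θ k).1 (Y x) ≠ (θ k).2) {δ : ℝ} (hδ : 0 < δ) :
    ∃ (A : Matrix (Fin r) (Fin n) ℝ) (β : Fin r → ℝ) (Ao : Matrix (Fin m) (Fin r) ℝ)
      (bo : Fin m → ℝ), eLpNorm (fun x => stepNet θ c b (Y x) - shallowNet σ A β Ao bo (Y x)) 2 μ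
        ≤ ENNReal.ofReal δ := by
  obtain ⟨M, hM⟩ := hσ.bounded
  set D : ℕ → Ω → Euc m := fun N x => ∑ k, ((if (θ k).2 < inner ℝ (θ k).1 (Y x) then 1 else 0 : ℝ)
    - σ (N * (inner ℝ (θ k).1 (Y x) - (θ k).2))) • c k with hD
  have hnet : ∀ (N : ℕ) x, stepNet θ c b (Y x) - shallowNet σ
      (Matrix.of fun k i => N * (θ k).1 i) (fun k => -(N * (θ k).2))
      (Matrix.of fun j k => c k j) (fun j => b j) (Y x) = D N x := fun N x => by
    ext j
    simp only [hD, stepNet, shallowNet, sub_smul, Finset.sum_sub_distrib, PiLp.sub_apply,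
      PiLp.add_apply, WithLp.ofLp_sum, Finset.sum_apply, PiLp.smul_apply, smul_eq_mul,
      Matrix.of_apply]
    have : ∀ k, (∑ i, (N : ℝ) * (θ k).1 i * Y x i) + -(N * (θ k).2)
        = N * (inner ℝ (θ k).1 (Y x) - (θ k).2) := fun k => by
      rw [PiLp.inner_apply, mul_sub, Finset.mul_sum, sub_eq_add_neg]
      congr 1
      refine Finset.sum_congr rfl fun i _ => ?_
      simp; ring
    simp_rw [this, mul_comm (c _ j)]
    ring
  have hDm : ∀ N, Measurable (D N) := fun N => by
    refine Finset.measurable_fun_sum _ fun k _ => Measurable.smul_const (Measurable.sub ?_ ?_) _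
    · exact Measurable.ite (measurableSet_lt measurable_const (measurable_const.inner hY))
        measurable_const measurable_const
    · exact hσ.measurable.comp (((measurable_const.inner hY).sub_const _).const_mul _)
  set κ : ℝ := ∑ k, (1 + M) * ‖c k‖ with hκ
  have hDb : ∀ N x, ‖D N x‖ ≤ κ := fun N x => by
    refine norm_sum_le_of_le _ fun k _ => ?_
    rw [norm_smul]
    refine mul_le_mul_of_nonneg_right ((norm_sub_le _ _).trans (add_le_add ?_ (hM _)))
      (norm_nonneg _)
    split_ifs <;> simp
  -- Pointwise convergence off the jumps, with the constant bound κ, gives L² convergence on a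
  -- finite measure space.
  have hDt : ∀ᵐ x ∂μ, Tendsto (fun N => D N x) atTop (𝓝 0) := by
    filter_upwards [ae_all_iff.mpr hθ] with x hx
    have : (0 : Euc m) = ∑ k, (0 : ℝ) • c k := by simp
    rw [this]
    refine tendsto_finsetSum _ fun k _ => Tendsto.smul_const ?_ _
    simpa using (hσ.tendsto_step (hx k)).const_sub
      (if (θ k).2 < inner ℝ (θ k).1 (Y x) then 1 else 0 : ℝ)
  have hlim : Tendsto (fun N => ∫⁻ x, ‖D N x‖ₑ ^ 2 ∂μ) atTop (𝓝 (∫⁻ _, 0 ∂μ)) := by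
    refine tendsto_lintegral_of_dominated_convergence (fun _ => ENNReal.ofReal κ ^ 2)
      (fun N => (hDm N).enorm.pow_const 2) (fun N => ae_of_all _ fun x => ?_) ?_ ?_
    · simp only [← ofReal_norm]
      gcongr
      exact hDb N x
    · rw [lintegral_const]
      finiteness
    · filter_upwards [hDt] with x hx
      simpa [Function.comp_def] using ((ENNReal.continuous_pow 2).tendsto _).comp hx.enorm
  rw [lintegral_zero] at hlim
  have hpos : (0 : ℝ≥0∞) < ENNReal.ofReal δ ^ 2 := by positivity
  obtain ⟨N, hN⟩ := (hlim.eventually_le_const hpos).exists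
  refine ⟨Matrix.of fun k i => N * (θ k).1 i, fun k => -(N * (θ k).2),
    Matrix.of fun j k => c k j, fun j => b j, ?_⟩
  simp_rw [hnet]
  exact eLpNorm_two_le_iff.mpr hN

/-! ### One-layer approximation schemes -/

/-- `f` can be approximated by networks with one hidden layer of `r` nodes, up to `η` in `L²`, on
sets that are mapped to `B`, and up to `R` uniformly elsewhere (in both cases, up to an arbitrarily
small error in `L²`). -/
def ShallowApprox (σ : ℝ → ℝ) {n m : ℕ} (B : Set (Euc n)) (f : Euc n → Euc m) (r : ℕ)
    (η R : ℝ) : Prop :=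
  ∀ {Ω : Type} [MeasurableSpace Ω] (μ : Measure Ω) [IsProbabilityMeasure μ] (Y : Ω → Euc n),
    Measurable Y → ∀ S, MeasurableSet S → (∀ x ∈ S, Y x ∈ B) → ∀ δ : ℝ, 0 < δ →
    ∃ h : Euc n → Euc m, Measurable h ∧
      eLpNorm (fun x => f (Y x) - h (Y x)) 2 (μ.restrict S) ≤ ENNReal.ofReal η ∧
      (∀ y ∈ B, ∀ z, ‖f y - h z‖ ≤ R) ∧
      ∃ (A : Matrix (Fin r) (Fin n) ℝ) (β : Fin r → ℝ) (Ao : Matrix (Fin m) (Fin r) ℝ)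
        (bo : Fin m → ℝ), eLpNorm (fun x => h (Y x) - shallowNet σ A β Ao bo (Y x)) 2 μ
          ≤ ENNReal.ofReal δ

/-- Covers output dimension 0, where ε/(2√m) degenerates and no component forces C ≥ 0; the bound
2C√m is then 0. -/
theorem shallowApprox_of_subsingleton (σ : ℝ → ℝ) {n m : ℕ} [Subsingleton (Euc m)]
    (B : Set (Euc n)) (f : Euc n → Euc m) (r : ℕ) (η : ℝ) {R : ℝ} (hR : 0 ≤ R) :
    ShallowApprox σ B f r η R := by
  intro Ω _ μ _ Y _ S _ _ δ _
  refine ⟨fun _ => 0, measurable_const, ?_, fun y _ z => ?_, 0, 0, 0, 0, ?_⟩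
  · have : (fun x => f (Y x) - 0) = 0 := funext fun x => Subsingleton.elim _ _
    rw [this]; simp
  · rw [Subsingleton.elim (f y - 0) 0, norm_zero]
    exact hR
  · have : (fun x => 0 - shallowNet σ (0 : Matrix (Fin r) (Fin n) ℝ) 0
        (0 : Matrix (Fin m) (Fin r) ℝ) 0 (Y x)) = 0 := funext fun x => Subsingleton.elim _ _
    rw [this]; simp

/-- The number of nodes per coordinate in Barron's theorem. -/
theorem sq_le_sq_mul_ceil {C ε : ℝ} (hε : 0 < ε) {m : ℕ} (hm : 0 < m) :
    C ^ 2 ≤ (ε / 2 / √m) ^ 2 * (⌈4 * C ^ 2 * m / ε ^ 2⌉₊ : ℝ) := by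
  have hm' : (0 : ℝ) < m := by exact_mod_cast hm
  have h := Nat.le_ceil (4 * C ^ 2 * m / ε ^ 2)
  rw [div_pow, Real.sq_sqrt hm'.le]
  calc C ^ 2 = (ε / 2) ^ 2 / m * (4 * C ^ 2 * m / ε ^ 2) := by field_simp; norm_num
    _ ≤ _ := by gcongr

/-- Sampling whole vectors gives the stronger bounds ε/(2√m) and 2C; they are weakened to those
available coordinatewise. -/
theorem IsBarronVec.shallowApprox {σ : ℝ → ℝ} (hσ : IsSigmoidal σ) {n m : ℕ} {B : Set (Euc n)}
    {C : ℝ} {f : Euc n → Euc m} (hB : Bornology.IsBounded B) (hf : IsBarronVec B C f) {ε : ℝ}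
    (hε : 0 < ε) :
    ShallowApprox σ B f ⌈4 * C ^ 2 * m / ε ^ 2⌉₊ (ε / 2) (2 * C * √m) := by
  rcases Nat.eq_zero_or_pos m with rfl | hm
  · exact shallowApprox_of_subsingleton _ _ _ _ _ (by simp)
  have hC : 0 ≤ C := (hf.exists_integral_centredStep hB).1
  have hm1 : 1 ≤ √(m : ℝ) := Real.one_le_sqrt.mpr (by exact_mod_cast hm)
  intro Ω _ μ _ Y hY S hS hYS δ hδ
  obtain ⟨θ, c, b, hθ, hL, hR⟩ := hf.exists_stepNet hB μ hY hS hYS _ (sq_le_sq_mul_ceil hε hm)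
  refine ⟨_, measurable_stepNet θ c b, hL.trans (ENNReal.ofReal_le_ofReal ?_), fun y hy z => ?_,
    hσ.exists_shallowNet μ hY θ c b hθ hδ⟩
  · rw [abs_of_pos (by positivity)]
    exact div_le_self (by positivity) hm1
  · exact (hR y hy z).trans (le_mul_of_one_le_right (by positivity) hm1)

theorem IsBarron.isBarronVec {n : ℕ} {B : Set (Euc n)} {C : ℝ} {f : Euc n → ℝ}
    (h : IsBarron B C f) :
    IsBarronVec B C fun x => (WithLp.toLp 2 fun _ => f x : Euc 1) := by
  obtain ⟨g, hg, hinv, hint, hC⟩ := h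
  have hn : ∀ ω, ‖fourierVec (fun x => (WithLp.toLp 2 fun _ => g x : Euc 1)) ω‖
      = ‖fourierT g ω‖ := fun ω => by
    rw [EuclideanSpace.norm_eq]
    simp [fourierVec]
  refine ⟨fun x => WithLp.toLp 2 fun _ => g x, fun x hx => ?_, fun _ => hinv, ?_, ?_⟩
  · simp only [hg hx]
  · simpa only [hn] using hint
  · simpa only [hn] using hC

/-- Each coordinate gets r nodes of its own, with output weights supported on it. The m squared
errors (ε/2)²/m add up to (ε/2)², and m squared uniform errors (2C)² give 2C√m. -/
theorem IsBarronComponentwise.shallowApprox {σ : ℝ → ℝ} (hσ : IsSigmoidal σ) {n m : ℕ}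
    {B : Set (Euc n)} {C : ℝ} {f : Euc n → Euc m} (hB : Bornology.IsBounded B)
    (hf : IsBarronComponentwise B C f) (hfm : Measurable f) {ε : ℝ} (hε : 0 < ε) :
    ShallowApprox σ B f (m * ⌈4 * C ^ 2 * m / ε ^ 2⌉₊) (ε / 2) (2 * C * √m) := by
  rcases Nat.eq_zero_or_pos m with rfl | hm
  · exact shallowApprox_of_subsingleton _ _ _ _ _ (by simp)
  have hm' : (0 : ℝ) < m := by exact_mod_cast hm
  have hC : 0 ≤ C := ((hf ⟨0, hm⟩).isBarronVec.exists_integral_centredStep hB).1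
  intro Ω _ μ _ Y hY S hS hYS δ hδ
  have hrC := sq_le_sq_mul_ceil (C := C) hε hm
  generalize ⌈4 * C ^ 2 * m / ε ^ 2⌉₊ = r at hrC ⊢
  have hex := fun j => (hf j).isBarronVec.exists_stepNet hB μ hY hS hYS r hrC
  choose θ c b hθ hL hR using hex
  set θ' : Fin (m * r) → Euc n × ℝ := fun k =>
    θ (finProdFinEquiv.symm k).1 (finProdFinEquiv.symm k).2 with hθ'
  set c' : Fin (m * r) → Euc m := fun k => EuclideanSpace.single (finProdFinEquiv.symm k).1
    (c (finProdFinEquiv.symm k).1 (finProdFinEquiv.symm k).2 0) with hc'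
  set b' : Euc m := WithLp.toLp 2 fun j => b j 0 with hb'
  have hcoord : ∀ z j, stepNet θ' c' b' z j = stepNet (θ j) (c j) (b j) z 0 := fun z j => by
    simp only [stepNet, PiLp.add_apply, WithLp.ofLp_sum, Finset.sum_apply, PiLp.smul_apply,
      smul_eq_mul, hb']
    congr 1
    rw [← finProdFinEquiv.sum_comp, Fintype.sum_prod_type, Finset.sum_eq_single j]
    · refine Finset.sum_congr rfl fun i _ => ?_
      simp only [hθ', hc', Equiv.symm_apply_apply, PiLp.single_apply, if_true]
    · intro i _ hij
      refine Finset.sum_eq_zero fun k _ => ?_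
      simp only [hθ', hc', Equiv.symm_apply_apply, PiLp.single_apply, if_neg hij.symm, mul_zero]
    · simp
  have hscalar : ∀ y z j, ‖(WithLp.toLp 2 fun _ => f y j : Euc 1) - stepNet (θ j) (c j) (b j) z‖
      = ‖(f y - stepNet θ' c' b' z) j‖ := fun y z j => by
    rw [EuclideanSpace.norm_eq]
    simp [hcoord, Real.sqrt_sq_eq_abs]
  refine ⟨_, measurable_stepNet θ' c' b', ?_, fun y hy z => ?_,
    hσ.exists_shallowNet μ hY θ' c' b' (fun k => hθ _ _) hδ⟩
  · rw [eLpNorm_two_le_iff]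
    have hsum : ∀ v : Euc m, ‖v‖ₑ ^ 2 = ∑ j, ‖v j‖ₑ ^ 2 := fun v => by
      simp_rw [← ofReal_norm, ← ENNReal.ofReal_pow (norm_nonneg _)]
      rw [EuclideanSpace.norm_sq_eq, ENNReal.ofReal_sum_of_nonneg fun j _ => by positivity]
    have hmeas : Measurable fun x => f (Y x) - stepNet θ' c' b' (Y x) :=
      (hfm.comp hY).sub ((measurable_stepNet θ' c' b').comp hY)
    have hmeasj : ∀ j, Measurable fun x => ‖(f (Y x) - stepNet θ' c' b' (Y x)) j‖ₑ ^ 2 :=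
      fun j => ((EuclideanSpace.proj (𝕜 := ℝ) j).continuous.measurable.comp hmeas).enorm.pow_const 2
    simp_rw [hsum]
    rw [lintegral_finsetSum _ fun j _ => hmeasj j]
    have hj : ∀ j ∈ Finset.univ, ∫⁻ x in S, ‖(f (Y x) - stepNet θ' c' b' (Y x)) j‖ₑ ^ 2 ∂μ
        ≤ ENNReal.ofReal ((ε / 2) ^ 2 / m) := fun j _ => by
      have := eLpNorm_two_le_iff.mp (hL j)
      simp_rw [← ofReal_norm, hscalar] at this
      simp_rw [← ofReal_norm]
      refine this.trans (le_of_eq ?_)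
      rw [← ENNReal.ofReal_pow (abs_nonneg _), sq_abs, div_pow _ (√_), Real.sq_sqrt hm'.le]
    refine (Finset.sum_le_sum hj).trans (le_of_eq ?_)
    rw [Finset.sum_const, Finset.card_univ, Fintype.card_fin, ← ENNReal.ofReal_nsmul,
      ← ENNReal.ofReal_pow (by positivity), nsmul_eq_mul, mul_div_cancel₀ _ hm'.ne']
  · rw [← abs_of_nonneg (by positivity : 0 ≤ 2 * C * √m), ← abs_of_nonneg (norm_nonneg _)]
    refine sq_le_sq.mp ?_
    rw [EuclideanSpace.norm_sq_eq, mul_pow, Real.sq_sqrt hm'.le]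
    refine (Finset.sum_le_sum (g := fun _ => (2 * C) ^ 2) fun j _ => ?_).trans ?_
    · rw [← hscalar]
      exact pow_le_pow_left₀ (norm_nonneg _) (hR j y hy z) 2
    · simp [mul_comm]

/-! ### Composition of a network with a network with one hidden layer -/

theorem sum_matrix_mul_apply_mul {a b c : ℕ} (A : Matrix (Fin a) (Fin b) ℝ)
    (B : Matrix (Fin b) (Fin c) ℝ) (v : Fin c → ℝ) (j : Fin a) :
    ∑ k, (A * B) j k * v k = ∑ i, A j i * ∑ k, B i k * v k := by
  simp only [Matrix.mul_apply, Finset.sum_mul, Finset.mul_sum, mul_assoc]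
  exact Finset.sum_comm

/-- Append a hidden layer and a new output layer after the output layer of a network, and merge the
old output layer into the new hidden layer. -/
noncomputable def NeuralNetwork.extend {p q q' l : ℕ} {w : ℕ → ℕ} (N : NeuralNetwork p q l w)
    (A : Matrix (Fin (w (l + 1))) (Fin q) ℝ) (β : Fin (w (l + 1)) → ℝ)
    (Ao : Matrix (Fin q') (Fin (w (l + 1))) ℝ) (bo : Fin q' → ℝ) :
    NeuralNetwork p q' (l + 1) w where
  A := Fin.snoc (α := fun i : Fin (l + 1) =>
    Matrix (Fin (layerSize p w (i + 1))) (Fin (layerSize p w i)) ℝ) N.A (A * N.Aout)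
  b := Fin.snoc (α := fun i : Fin (l + 1) => Fin (layerSize p w (i + 1)) → ℝ) N.b
    (fun j => (∑ k, A j k * N.bout k) + β j)
  Aout := Ao
  bout := bo

theorem NeuralNetwork.layer_extend {p q q' l : ℕ} {w : ℕ → ℕ} (N : NeuralNetwork p q l w)
    (A : Matrix (Fin (w (l + 1))) (Fin q) ℝ) (β : Fin (w (l + 1)) → ℝ)
    (Ao : Matrix (Fin q') (Fin (w (l + 1))) ℝ) (bo : Fin q' → ℝ) (σ : ℝ → ℝ) (x : Euc p) :
    ∀ i (h : i ≤ l), (N.extend A β Ao bo).layer σ x i (h.trans l.le_succ) = N.layer σ x i h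
  | 0, _ => rfl
  | i + 1, h => by
    have hA : (N.extend A β Ao bo).A ⟨i, Nat.lt_succ_of_lt h⟩ = N.A ⟨i, h⟩ :=
      Fin.snoc_castSucc (α := fun i : Fin (l + 1) =>
        Matrix (Fin (layerSize p w (i + 1))) (Fin (layerSize p w i)) ℝ) _ _ ⟨i, h⟩
    have hb : (N.extend A β Ao bo).b ⟨i, Nat.lt_succ_of_lt h⟩ = N.b ⟨i, h⟩ :=
      Fin.snoc_castSucc (α := fun i : Fin (l + 1) => Fin (layerSize p w (i + 1)) → ℝ) _ _ ⟨i, h⟩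
    funext j
    simp only [NeuralNetwork.layer]
    rw [N.layer_extend A β Ao bo σ x i (Nat.le_of_succ_le h), hA, hb]

theorem NeuralNetwork.eval_extend {p q q' l : ℕ} {w : ℕ → ℕ} (N : NeuralNetwork p q l w)
    (A : Matrix (Fin (w (l + 1))) (Fin q) ℝ) (β : Fin (w (l + 1)) → ℝ)
    (Ao : Matrix (Fin q') (Fin (w (l + 1))) ℝ) (bo : Fin q' → ℝ) (σ : ℝ → ℝ) (x : Euc p) :
    (N.extend A β Ao bo).eval σ x = shallowNet σ A β Ao bo (N.eval σ x) := by
  have hA : (N.extend A β Ao bo).A ⟨l, l.lt_succ_self⟩ = A * N.Aout :=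
    Fin.snoc_last (α := fun i : Fin (l + 1) =>
      Matrix (Fin (layerSize p w (i + 1))) (Fin (layerSize p w i)) ℝ) _ _
  have hb : (N.extend A β Ao bo).b ⟨l, l.lt_succ_self⟩
      = fun j => (∑ k, A j k * N.bout k) + β j :=
    Fin.snoc_last (α := fun i : Fin (l + 1) => Fin (layerSize p w (i + 1)) → ℝ) _ _
  have hlayer : ∀ j, (N.extend A β Ao bo).layer σ x (l + 1) le_rfl j
      = σ ((∑ i, A j i * N.eval σ x i) + β j) := fun j => by
    rw [NeuralNetwork.layer, N.layer_extend A β Ao bo σ x l le_rfl, hA, hb]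
    change σ ((∑ k, (A * N.Aout) j k * N.layer σ x l le_rfl k)
      + ((∑ k, A j k * N.bout k) + β j)) = _
    have e : ∑ k, (A * N.Aout) j k * N.layer σ x l le_rfl k
        = ∑ i, A j i * ∑ k, N.Aout i k * N.layer σ x l le_rfl k :=
      sum_matrix_mul_apply_mul A N.Aout _ j
    rw [e, ← add_assoc, ← Finset.sum_add_distrib]
    simp only [NeuralNetwork.eval, mul_add]
  ext j
  simp only [NeuralNetwork.eval, shallowNet] at hlayer ⊢
  simp only [hlayer]
  rfl

/-- The network without hidden layers that computes the identity. -/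
noncomputable def NeuralNetwork.idNet (p : ℕ) (w : ℕ → ℕ) : NeuralNetwork p p 0 w where
  A := fun i => i.elim0
  b := fun i => i.elim0
  Aout := (1 : Matrix (Fin p) (Fin p) ℝ)
  bout := 0

theorem NeuralNetwork.eval_idNet (p : ℕ) (w : ℕ → ℕ) (σ : ℝ → ℝ) (x : Euc p) :
    (NeuralNetwork.idNet p w).eval σ x = x := by
  ext j
  simp only [NeuralNetwork.eval, NeuralNetwork.layer, NeuralNetwork.idNet]
  change (∑ k : Fin p, (1 : Matrix (Fin p) (Fin p) ℝ) j k * x k) + 0 = x j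
  simp [Matrix.one_apply]

theorem NeuralNetwork.measurable_layer {p q l : ℕ} {w : ℕ → ℕ} (N : NeuralNetwork p q l w)
    {σ : ℝ → ℝ} (hσ : Measurable σ) : ∀ i (h : i ≤ l) j, Measurable fun x => N.layer σ x i h j
  | 0, _, j => (EuclideanSpace.proj (𝕜 := ℝ) j).continuous.measurable
  | i + 1, h, j => by
    simp only [NeuralNetwork.layer]
    exact hσ.comp ((Finset.measurable_fun_sum _ fun k _ =>
      (N.measurable_layer hσ i (Nat.le_of_succ_le h) k).const_mul _).add_const _)

theorem NeuralNetwork.measurable_eval {p q l : ℕ} {w : ℕ → ℕ} (N : NeuralNetwork p q l w)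
    {σ : ℝ → ℝ} (hσ : Measurable σ) : Measurable (N.eval σ) := by
  refine (PiLp.continuous_toLp 2 _).measurable.comp (measurable_pi_lambda _ fun j => ?_)
  exact (Finset.measurable_fun_sum _ fun k _ =>
    (N.measurable_layer hσ l le_rfl k).const_mul _).add_const _

/-! ### Chains of Lipschitz functions -/

section chain

variable {m : ℕ → ℕ} {f : ∀ i, Euc (m i) → Euc (m (i + 1))}

theorem continuous_chain {l : ℕ} (hLip : ∀ i < l, LipschitzWith 1 (f i)) : Continuous (chain f l) := by
  induction l with
  | zero => exact continuous_id
  | succ l ih =>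
    exact (hLip l l.lt_succ_self).continuous.comp
      (ih fun i hi => hLip i (hi.trans l.lt_succ_self))

theorem chain_mem {K : ∀ i, Set (Euc (m i))} {l : ℕ} (hchain : ∀ i < l, f i '' K i ⊆ K (i + 1))
    {x : Euc (m 0)} (hx : x ∈ K 0) : chain f l x ∈ K l := by
  induction l with
  | zero => exact hx
  | succ l ih =>
    exact hchain l l.lt_succ_self
      ⟨_, ih fun i hi => hchain i (hi.trans l.lt_succ_self), rfl⟩

theorem subset_barronDomain (K : ∀ i, Set (Euc (m i))) {s : ℝ} (i : ℕ) :
    K i ⊆ barronDomain K s i := by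
  cases i with
  | zero => exact subset_rfl
  | succ i =>
    intro x hx
    exact ⟨x, hx, 0, ⟨0, by simp, by simp⟩, by simp⟩

theorem mem_barronDomain_succ {K : ∀ i, Set (Euc (m i))} {s : ℝ} (hs : 0 < s) {i : ℕ}
    {x y : Euc (m (i + 1))} (hx : x ∈ K (i + 1)) (hxy : ‖x - y‖ ≤ s) :
    y ∈ barronDomain K s (i + 1) := by
  refine ⟨x, hx, y - x, ⟨s⁻¹ • (y - x), ?_, ?_⟩, by simp⟩
  · rw [mem_closedBall_zero_iff, norm_smul, norm_inv, Real.norm_of_nonneg hs.le, norm_sub_rev,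
      inv_mul_le_iff₀ hs, mul_one]
    exact hxy
  · simp [smul_smul, hs.ne']

theorem isBounded_barronDomain {K : ∀ i, Set (Euc (m i))} {s : ℝ} {i : ℕ}
    (hK : Bornology.IsBounded (K i)) : Bornology.IsBounded (barronDomain K s i) := by
  cases i with
  | zero => exact hK
  | succ i => exact hK.add (Metric.isBounded_closedBall.smul₀ s)

end chain

/-! ### Coupling and error propagation -/

/-- The random variables `F` and `G` on one probability space give a coupling of their laws. -/
theorem wasserstein_two_map_le {Ω : Type*} [MeasurableSpace Ω] {n : ℕ} (μ : Measure Ω)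
    {F G : Ω → Euc n} (hF : Measurable F) (hG : Measurable G) :
    wasserstein 2 (μ.map F) (μ.map G) ≤ eLpNorm (fun x => F x - G x) 2 μ := by
  have hc : IsCoupling (μ.map fun x => (F x, G x)) (μ.map F) (μ.map G) := by
    constructor
    · rw [Measure.map_map measurable_fst (hF.prodMk hG)]; rfl
    · rw [Measure.map_map measurable_snd (hF.prodMk hG)]; rfl
  rw [wasserstein, eLpNorm_eq_lintegral_rpow_enorm_toReal two_ne_zero ENNReal.ofNat_ne_top,
    ENNReal.toReal_ofNat]
  refine ENNReal.rpow_le_rpow ((iInf₂_le (μ.map fun x => (F x, G x)) hc).trans (le_of_eq ?_)) (by norm_num)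
  rw [lintegral_map (by fun_prop) (hF.prodMk hG)]
  refine lintegral_congr fun x => ?_
  rw [← ofReal_norm, ENNReal.ofReal_rpow_of_nonneg (norm_nonneg _) zero_le_two]

/-- Error propagation in `L²` through a `1`-Lipschitz function and its approximation. -/
theorem eLpNorm_comp_sub_le {Ω : Type*} [MeasurableSpace Ω] {n m : ℕ} {ν : Measure Ω}
    {f h : Euc n → Euc m} (hf : LipschitzWith 1 f) (hh : Measurable h) {F G : Ω → Euc n}
    (hF : Measurable F) (hG : Measurable G) {a b : ℝ} (ha : 0 ≤ a) (hb : 0 ≤ b)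
    (hFG : eLpNorm (fun x => F x - G x) 2 ν ≤ ENNReal.ofReal a)
    (hfh : eLpNorm (fun x => f (G x) - h (G x)) 2 ν ≤ ENNReal.ofReal b) :
    eLpNorm (fun x => f (F x) - h (G x)) 2 ν ≤ ENNReal.ofReal (a + b) := by
  have hfm := hf.continuous.measurable
  have e : (fun x => f (F x) - h (G x))
      = (fun x => f (F x) - f (G x)) + fun x => f (G x) - h (G x) := by
    funext x; simp
  rw [e, ENNReal.ofReal_add ha hb]
  refine (eLpNorm_add_le ?_ ?_ one_le_two).trans (add_le_add (le_trans ?_ hFG) hfh)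
  · exact ((hfm.comp hF).sub (hfm.comp hG)).aestronglyMeasurable
  · exact ((hfm.comp hG).sub (hh.comp hG)).aestronglyMeasurable
  · exact eLpNorm_mono fun x => by simpa using hf.norm_sub_le (F x) (G x)

theorem eLpNorm_sub_le_ofReal_add {Ω : Type*} [MeasurableSpace Ω] {m : ℕ} {ν : Measure Ω}
    {F H G : Ω → Euc m} (hF : Measurable F) (hH : Measurable H) (hG : Measurable G) {a b : ℝ}
    (ha : 0 ≤ a) (hb : 0 ≤ b) (hFH : eLpNorm (fun x => F x - H x) 2 ν ≤ ENNReal.ofReal a)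
    (hHG : eLpNorm (fun x => H x - G x) 2 ν ≤ ENNReal.ofReal b) :
    eLpNorm (fun x => F x - G x) 2 ν ≤ ENNReal.ofReal (a + b) := by
  have e : (fun x => F x - G x) = (fun x => F x - H x) + fun x => H x - G x := by
    funext x; simp
  rw [e, ENNReal.ofReal_add ha hb]
  exact (eLpNorm_add_le (hF.sub hH).aestronglyMeasurable (hH.sub hG).aestronglyMeasurable
    one_le_two).trans (add_le_add hFH hHG)

/-! ### Induction over the layers -/

section

variable {m : ℕ → ℕ} {f : ∀ i, Euc (m i) → Euc (m (i + 1))} {K : ∀ i, Set (Euc (m i))}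
  {ε s : ℝ} {μ₀ : Measure (Euc (m 0))} [IsProbabilityMeasure μ₀] {σ : ℝ → ℝ} {w : ℕ → ℕ} {R : ℕ → ℝ}

/-- Inductive construction of a network that approximates the chain in `L²` on a large set, from
which its outputs stay in the domain of the next function. -/
theorem exists_network_on_large_set (hε : 0 < ε) (hs : 0 < s) (hsupp : μ₀.support ⊆ K 0)
    (hσ : Measurable σ) (l : ℕ) (hLip : ∀ i < l, LipschitzWith 1 (f i))
    (hf : ∀ i < l, ShallowApprox σ (barronDomain K s i) (f i) (w (i + 1)) (ε / 2) (R i))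
    (hchain : ∀ i < l, f i '' K i ⊆ K (i + 1)) :
    ∃ (N : NeuralNetwork (m 0) (m l) l w) (S : Set (Euc (m 0))), MeasurableSet S ∧
      S ⊆ μ₀.support ∧ (∀ x ∈ S, N.eval σ x ∈ barronDomain K s l) ∧
      μ₀ Sᶜ ≤ ENNReal.ofReal (∑ i ∈ Finset.range l, ((i + 1) * ε / s) ^ 2) ∧
      eLpNorm (fun x => chain f l x - N.eval σ x) 2 (μ₀.restrict S) ≤ ENNReal.ofReal (l * ε) := by
  induction l with
  -- The support is closed and of full measure, so no mass is lost at the start.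
  | zero =>
    refine ⟨NeuralNetwork.idNet (m 0) w, μ₀.support, Measure.isClosed_support.measurableSet,
      subset_rfl, fun x hx => ?_, ?_, ?_⟩
    · rw [NeuralNetwork.eval_idNet]
      exact hsupp hx
    · rw [Measure.measure_compl_support]; simp
    · simp only [NeuralNetwork.eval_idNet]
      simp [chain]
  | succ l ih =>
    have hll := l.lt_succ_self
    obtain ⟨N, S, hS, hSs, hSd, hSμ, hSe⟩ := ih (fun i hi => hLip i (hi.trans hll))
      (fun i hi => hf i (hi.trans hll)) (fun i hi => hchain i (hi.trans hll))
    have hG := N.measurable_eval hσ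
    have hF : Measurable (chain f l) :=
      (continuous_chain fun i hi => hLip i (hi.trans hll)).measurable
    obtain ⟨h, hh, hL, -, A, β, Ao, bo, hδ⟩ :=
      hf l hll μ₀ (N.eval σ) hG S hS hSd (ε / 2) (by positivity)
    set N' := N.extend A β Ao bo with hN'
    have hN'e : ∀ x, N'.eval σ x = shallowNet σ A β Ao bo (N.eval σ x) :=
      N.eval_extend A β Ao bo σ
    have hG' := N'.measurable_eval hσ
    have hF' : Measurable (chain f (l + 1)) := (continuous_chain hLip).measurable
    have hstep : eLpNorm (fun x => chain f (l + 1) x - N'.eval σ x) 2 (μ₀.restrict S)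
        ≤ ENNReal.ofReal ((l + 1 : ℕ) * ε) := by
      have h1 := eLpNorm_comp_sub_le (hLip l hll) hh hF hG (by positivity) (by positivity) hSe hL
      have h2 : eLpNorm (fun x => h (N.eval σ x) - N'.eval σ x) 2 (μ₀.restrict S)
          ≤ ENNReal.ofReal (ε / 2) := by
        simp only [hN'e]
        exact (eLpNorm_mono_measure _ Measure.restrict_le_self).trans hδ
      refine (eLpNorm_sub_le_ofReal_add hF' (hh.comp hG) hG' (by positivity) (by positivity)
        h1 h2).trans (le_of_eq ?_)
      congr 1; push_cast; ring
    have hD : Measurable fun x => ‖chain f (l + 1) x - N'.eval σ x‖ := (hF'.sub hG').norm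
    -- The exact value lies in K_{l+1}, so an error of at most s keeps the output in the next Barron
    -- domain.
    set E : Set (Euc (m 0)) := {x | ‖chain f (l + 1) x - N'.eval σ x‖ ≤ s} with hE
    have hEm : MeasurableSet E := measurableSet_le hD measurable_const
    refine ⟨N', S ∩ E, hS.inter hEm, Set.inter_subset_left.trans hSs, fun x hx => ?_, ?_, ?_⟩
    · exact mem_barronDomain_succ hs (chain_mem hchain (hsupp (hSs hx.1))) hx.2
    · have hsub : (S ∩ E)ᶜ ⊆ Sᶜ ∪ (Eᶜ ∩ S) := by
        intro x hx
        by_cases hxS : x ∈ S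
        · exact Or.inr ⟨fun hxE => hx ⟨hxS, hxE⟩, hxS⟩
        · exact Or.inl hxS
      -- Chebyshev is applied on `S` only, where the L² error is known to be at most (l+1)ε.
      have hcheb : μ₀ (Eᶜ ∩ S) ≤ ENNReal.ofReal (((l + 1) * ε / s) ^ 2) := by
        rw [← Measure.restrict_apply hEm.compl]
        have h1 := meas_ge_le_mul_pow_eLpNorm_enorm (μ₀.restrict S) (p := 2) two_ne_zero
          ENNReal.ofNat_ne_top (hF'.sub hG').aestronglyMeasurable (ε := ENNReal.ofReal s)
          (by simpa using hs) (by simp)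
        refine (measure_mono fun x hx => ?_).trans (h1.trans ?_)
        · have : s < ‖chain f (l + 1) x - N'.eval σ x‖ := not_le.mp hx
          change ENNReal.ofReal s ≤ ‖chain f (l + 1) x - N'.eval σ x‖ₑ
          rw [← ofReal_norm]
          exact ENNReal.ofReal_le_ofReal this.le
        · rw [ENNReal.toReal_ofNat, ENNReal.rpow_ofNat, ENNReal.rpow_ofNat, ← mul_pow,
            ENNReal.ofReal_pow (by positivity)]
          gcongr
          rw [div_eq_mul_inv, mul_comm _ s⁻¹, ENNReal.ofReal_mul (by positivity),
            ENNReal.ofReal_inv_of_pos hs]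
          gcongr
          exact hstep.trans_eq (by push_cast; rfl)
      rw [Finset.sum_range_succ, ENNReal.ofReal_add (by positivity) (by positivity)]
      exact (measure_mono hsub).trans ((measure_union_le _ _).trans (add_le_add hSμ hcheb))
    · exact (eLpNorm_mono_measure _
        (Measure.restrict_mono Set.inter_subset_left le_rfl)).trans hstep

theorem sum_range_succ_sq (l : ℕ) :
    ∑ i ∈ Finset.range l, ((i : ℝ) + 1) ^ 2 = (l : ℝ) * (l + 1) * (2 * l + 1) / 6 := by
  induction l with
  | zero => simp
  | succ l ih => rw [Finset.sum_range_succ, ih]; push_cast; ring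

/-- The total squared error is smaller than the square of the claimed bound. -/
theorem sq_add_mul_sum_lt {ε s R D : ℝ} (hε : 0 < ε) (hs : 0 < s) (hR : 0 ≤ R) (hD : 0 ≤ D)
    (l : ℕ) :
    (l * ε + ε / 2) ^ 2 + R ^ 2 * ∑ i ∈ Finset.range l, (((i : ℝ) + 1) * ε / s) ^ 2
      < ((l + 1 : ℕ) * ε) ^ 2 * (1 + (R + D) ^ 2 * ((l + 1 : ℕ) / (3 * s ^ 2))) := by
  have e : ∑ i ∈ Finset.range l, (((i : ℝ) + 1) * ε / s) ^ 2
      = l * (l + 1) * (2 * l + 1) / 6 * (ε ^ 2 / s ^ 2) := by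
    rw [← sum_range_succ_sq, Finset.sum_mul]
    exact Finset.sum_congr rfl fun i _ => by ring
  rw [e]
  have hl : (0 : ℝ) ≤ l := l.cast_nonneg
  -- The only strict inequality: it leaves room for the sigmoidal error of the last layer.
  have h1 : (l * ε + ε / 2) ^ 2 < (((l + 1 : ℕ) : ℝ) * ε) ^ 2 := by
    push_cast
    gcongr
    linarith
  have h2 : (l : ℝ) * (l + 1) * (2 * l + 1) / 6 ≤ ((l : ℝ) + 1) ^ 3 / 3 := by nlinarith
  -- R alone already suffices, because f(y) is compared directly with h(z); D merely enlarges the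
  -- bound.
  have h3 : R ^ 2 ≤ (R + D) ^ 2 := by gcongr; linarith
  have h4 : R ^ 2 * ((l : ℝ) * (l + 1) * (2 * l + 1) / 6 * (ε ^ 2 / s ^ 2))
      ≤ (R + D) ^ 2 * (((l : ℝ) + 1) ^ 3 / 3 * (ε ^ 2 / s ^ 2)) := by gcongr
  have h5 : (((l + 1 : ℕ) : ℝ) * ε) ^ 2 * (1 + (R + D) ^ 2 * ((l + 1 : ℕ) / (3 * s ^ 2)))
      = (((l + 1 : ℕ) : ℝ) * ε) ^ 2
        + (R + D) ^ 2 * (((l : ℝ) + 1) ^ 3 / 3 * (ε ^ 2 / s ^ 2)) := by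
    push_cast
    field_simp
  rw [h5]
  linarith

/-- The multilayer Barron theorem for an arbitrary one-layer approximation scheme. -/
theorem exists_network_wasserstein_le (hε : 0 < ε) (hs : 0 < s) (hsupp : μ₀.support ⊆ K 0)
    (hσ : Measurable σ) (l : ℕ) (hLip : ∀ i < l + 1, LipschitzWith 1 (f i))
    (hf : ∀ i < l + 1, ShallowApprox σ (barronDomain K s i) (f i) (w (i + 1)) (ε / 2) (R i))
    (hchain : ∀ i < l + 1, f i '' K i ⊆ K (i + 1)) {D : ℝ} (hD : 0 ≤ D) :
    ∃ N : NeuralNetwork (m 0) (m (l + 1)) (l + 1) w,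
      wasserstein 2 (μ₀.map (chain f (l + 1))) (μ₀.map (N.eval σ)) ≤
        ENNReal.ofReal ((l + 1 : ℕ) * ε *
          √(1 + (R l + D) ^ 2 * ((l + 1 : ℕ) / (3 * s ^ 2)))) := by
  have hll := l.lt_succ_self
  obtain ⟨N, S, hS, hSs, hSd, hSμ, hSe⟩ := exists_network_on_large_set hε hs hsupp hσ l
    (fun i hi => hLip i (hi.trans hll)) (fun i hi => hf i (hi.trans hll))
    (fun i hi => hchain i (hi.trans hll))
  have hG := N.measurable_eval hσ
  have hF : Measurable (chain f l) :=
    (continuous_chain fun i hi => hLip i (hi.trans hll)).measurable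
  have hF' : Measurable (chain f (l + 1)) := (continuous_chain hLip).measurable
  have hdom : ∀ x ∈ μ₀.support, chain f l x ∈ barronDomain K s l := fun x hx =>
    subset_barronDomain K l (chain_mem (fun i hi => hchain i (hi.trans hll)) (hsupp hx))
  -- R l bounds a norm as soon as the domain has a point, and the support of a probability measure
  -- is nonempty.
  have hR : 0 ≤ R l := by
    obtain ⟨x, hx⟩ := Measure.nonempty_support (IsProbabilityMeasure.ne_zero μ₀)
    obtain ⟨h, -, -, hb, -⟩ := hf l hll μ₀ (N.eval σ) hG S hS hSd 1 one_pos
    exact (norm_nonneg _).trans (hb _ (hdom x hx) 0)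
  set V : ℝ := (l * ε + ε / 2) ^ 2
    + R l ^ 2 * ∑ i ∈ Finset.range l, (((i : ℝ) + 1) * ε / s) ^ 2 with hV
  set T : ℝ := (l + 1 : ℕ) * ε * √(1 + (R l + D) ^ 2 * ((l + 1 : ℕ) / (3 * s ^ 2))) with hT
  have hV0 : 0 ≤ V := by positivity
  have hT0 : 0 ≤ T := by positivity
  have hVT : √V < T := by
    rw [Real.sqrt_lt' (by positivity), hT, mul_pow, Real.sq_sqrt (by positivity)]
    exact sq_add_mul_sum_lt hε hs hR hD l
  -- √V bounds the error with the step network as last layer; the sigmoids may use up the rest of T.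
  obtain ⟨h, hh, hL, hb, A, β, Ao, bo, hδ⟩ :=
    hf l hll μ₀ (N.eval σ) hG S hS hSd (T - √V) (sub_pos.mpr hVT)
  refine ⟨N.extend A β Ao bo, ?_⟩
  have hG' := (N.extend A β Ao bo).measurable_eval hσ
  refine (wasserstein_two_map_le μ₀ hF' hG').trans ?_
  have hmain : eLpNorm (fun x => chain f (l + 1) x - h (N.eval σ x)) 2 μ₀
      ≤ ENNReal.ofReal √V := by
    rw [eLpNorm_two_le_iff, ← ENNReal.ofReal_pow (Real.sqrt_nonneg _), Real.sq_sqrt hV0,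
      ← lintegral_add_compl _ hS, hV, ENNReal.ofReal_add (by positivity) (by positivity)]
    refine add_le_add ?_ ?_
    · have := eLpNorm_two_le_iff.mp
        (eLpNorm_comp_sub_le (hLip l hll) hh hF hG (by positivity) (by positivity) hSe hL)
      rwa [← ENNReal.ofReal_pow (by positivity)] at this
    -- Off `S` the network output may be anywhere, but the exact value is still in the Barron domain
    -- almost surely.
    · have hae : ∀ᵐ x ∂(μ₀.restrict Sᶜ),
          ‖chain f (l + 1) x - h (N.eval σ x)‖ₑ ^ 2 ≤ ENNReal.ofReal (R l ^ 2) := by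
        refine ae_restrict_of_ae ?_
        filter_upwards [Measure.support_mem_ae (μ := μ₀)] with x hx
        rw [← ofReal_norm, ENNReal.ofReal_pow hR]
        gcongr
        exact hb _ (hdom x hx) _
      refine (lintegral_mono_ae hae).trans ?_
      rw [lintegral_const, Measure.restrict_apply_univ, ENNReal.ofReal_mul (by positivity)]
      gcongr
  refine (eLpNorm_sub_le_ofReal_add hF' (hh.comp hG) hG' (Real.sqrt_nonneg V)
    (sub_nonneg.mpr hVT.le) hmain ?_).trans (le_of_eq (by congr 1; ring))
  simpa only [NeuralNetwork.eval_extend, Function.comp_apply] using hδ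

end

end BarronNet

/-! ### The two cases -/

theorem corollary3p3
    (l : ℕ) (hl : 1 ≤ l) (ε s : ℝ) (hε : 0 < ε) (hs : 0 < s)
    (m : ℕ → ℕ) (f : ∀ i, Euc (m i) → Euc (m (i + 1)))
    (K : ∀ i, Set (Euc (m i))) (C : ℕ → ℝ)
    (μ₀ : Measure (Euc (m 0))) [IsProbabilityMeasure μ₀]
    (hK : ∀ i < l, Bornology.IsBounded (K i))
    (hsupp : μ₀.support ⊆ K 0)
    (hLip : ∀ i < l, LipschitzWith 1 (f i))
    (hBarron : ∀ i < l, IsBarronComponentwise (barronDomain K s i) (C (i + 1)) (f i))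
    (hchain : ∀ i < l, f i '' K i ⊆ K (i + 1))
    (σ : ℝ → ℝ) (hσ : IsSigmoidal σ) :
    ((∀ i < l, IsBarronVec (barronDomain K s i) (C (i + 1)) (f i)) →
      ∃ g : NeuralNetwork (m 0) (m l) l (fun i => ⌈4 * C i ^ 2 * m i / ε ^ 2⌉₊),
        wasserstein 2 (μ₀.map (chain f l)) (μ₀.map (g.eval σ)) ≤
          ENNReal.ofReal (l * ε * √(1 +
            (2 * C l * √(m l) + Metric.diam (chain f l '' K 0)) ^ 2 * (l / (3 * s ^ 2))))) ∧
    ∃ g : NeuralNetwork (m 0) (m l) l (fun i => m i * ⌈4 * C i ^ 2 * m i / ε ^ 2⌉₊),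
      wasserstein 2 (μ₀.map (chain f l)) (μ₀.map (g.eval σ)) ≤
        ENNReal.ofReal (l * ε * √(1 +
          (2 * C l * √(m l) + Metric.diam (chain f l '' K 0)) ^ 2 * (l / (3 * s ^ 2)))) := by
  -- The last layer is treated apart from the others, so at least one is needed.
  obtain ⟨l, rfl⟩ : ∃ k, l = k + 1 := ⟨l - 1, by omega⟩
  have hB : ∀ i < l + 1, Bornology.IsBounded (barronDomain K s i) := fun i hi =>
    isBounded_barronDomain (hK i hi)
  refine ⟨fun hVec => ?_, ?_⟩
  · exact exists_network_wasserstein_le (R := fun i => 2 * C (i + 1) * √(m (i + 1))) hε hs hsupp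
      hσ.measurable l hLip (fun i hi => (hVec i hi).shallowApprox hσ (hB i hi) hε) hchain
      Metric.diam_nonneg
  · exact exists_network_wasserstein_le (R := fun i => 2 * C (i + 1) * √(m (i + 1))) hε hs hsupp
      hσ.measurable l hLip (fun i hi => (hBarron i hi).shallowApprox hσ (hB i hi)
        (hLip i hi).continuous.measurable hε) hchain Metric.diam_nonneg
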